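/- Let $\mathcal V$ be a category that is cartesian closed, has pullbacks, and is extensive, i.e. $\mathcal V$ has small coproducts and for every small family $(X_i)_{i\in I}$ the coproduct functor $\prod_i \mathcal V_{/X_i}\to \mathcal V_{/\coprod_i X_i}$ is an equivalence. Write $*$ for the terminal object. A family $\mathcal G$ of objects of $\mathcal V$ is *conservative* if a map $f\colon Y\to Z$ is an isomorphism if and only if $f_*\colon\mathcal V(X,Y)\to\mathcal V(X,Z)$ is bijective for every $X\in\mathcal G$. A $\mathcal V$-category $\mathcal C$ has all *$\mathcal V$-tensors by $X\in\mathcal V$* if for every $C\in\mathcal C$ there are an object $C\otimes X\in\mathcal C$ and a map $\gamma\colon X\to\mathcal C(C,C\otimes X)$ such that the induced map $\mathcal C(C\otimes X,A)\to[X,\mathcal C(C,A)]$ is an isomorphism for all $A\in\mathcal C$. An object $T$ of a $\mathcal V$-category $\mathcal D$ is *$\mathcal V$-terminal* if $\mathcal D(A,T)\to *$ is an isomorphism for all $A\in\mathcal D$. For a small $\mathcal V$-category $\mathcal D$, $\mathrm{Int}\,\mathcal D$ is the category internal to $\mathcal V$ with object of objects $\coprod_{A} *$, object of morphisms $\coprod_{A,B}\mathcal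 D(A,B)$, and identities and composition induced by those of $\mathcal D$. For an internal category $\mathbb A$, $\mathrm{Und}\,\mathbb A$ is the $\mathcal V$-category whose objects are the maps $*\to\mathbb A_0$ and whose hom-object from $A$ to $B$ is the pullback of $(s,t)\colon\mathbb A_1\to\mathbb A_0\times\mathbb A_0$ along $(A,B)\colon *\to\mathbb A_0\times\mathbb A_0$, with identities and composition induced by those of $\mathbb A$. For an internal functor $H\colon\mathbb A\to\mathbb B$ and $B\colon *\to\mathbb B_0$, the comma internal category $H\downarrow B$ is the pullback of $(H,B)\colon\mathbb A\to\mathbb B\times\mathbb B$ along (source, target) $\colon[\![\mathbb 2,\mathbb B]\!]\to\mathbb B\times\mathbb B$, where $[\![\mathbb 2,\mathbb B]\!]$ is the internal category of arrows and commutative squares in $\mathbb B$. Let $\mathcal C$ be a small $\mathcal V$-category and $\mathcal I$ a $\mathcal V$-category such that $\mathcal V$ has products indexed by the objects of $\mathcal I$, so that the $\mathcal V$-category $\mathcal V^{\mathcal I}$ of $\mathcal V$-functors $\mathcal I\to\mathcal V$ exists, with hom-objects the ends $\int_{\mathcal I}[F-,F'-]$. Let $G\colon\mathcal I\to\mathcal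 C$ and $W\colon\mathcal I\to\mathcal V$ be $\mathcal V$-functors, and let $\mathcal S$ be any small full sub-$\mathcal V$-category of $\mathcal V^{\mathcal I}$ containing $W$ and all $\mathcal C(A,G-)$ with $A\in\mathcal C$ (if $\mathcal V^{\mathcal I}$ is itself small, one may take $\mathcal S=\mathcal V^{\mathcal I}$). Let $W\downarrow\mathrm{Int}\,\mathcal C(-,G)$ be the comma internal category of the internal functor $\mathrm{Int}\,\mathcal C\to\mathrm{Int}(\mathcal S^{\mathrm{op}})$ induced by $\mathcal C(-,G)\colon\mathcal C^{\mathrm{op}}\to\mathcal S$ over the element $W$. A pair $(L,\lambda)$ of an object $L\in\mathcal C$ and a $\mathcal V$-natural transformation $\lambda\colon W\Rightarrow\mathcal C(L,G-)$ determines an object of $\mathrm{Und}(W\downarrow\mathrm{Int}\,\mathcal C(-,G))$, and it is called a *$W$-weighted $\mathcal V$-limit* of $G$ if the induced $\mathcal V$-natural transformation $\lambda^*\colon\mathcal C(-,L)\Rightarrow\mathcal V^{\mathcal I}(W,\mathcal C(-,G))$ of $\mathcal V$-functors $\mathcal C^{\mathrm{op}}\to\mathcal V$ is an isomorphism. **Theorem.**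 Let $\mathcal G$ be a conservative family of objects of $\mathcal V$, and suppose that $\mathcal C$ has all $\mathcal V$-tensors by $X$ for every $X\in\mathcal G$. Then, for every pair $(L,\lambda)$ as above, the following are equivalent: 1. $(L,\lambda)$ is a $W$-weighted $\mathcal V$-limit of $G$; 2. $(L,\lambda)$ is a $\mathcal V$-terminal object of the underlying $\mathcal V$-category $\mathrm{Und}(W\downarrow\mathrm{Int}\,\mathcal C(-,G))$. -/

import Mathlib

open CategoryTheory Limits MonoidalCategory CartesianMonoidalCategory MonoidalClosed Opposite

universe w w₁ w₂ v u

noncomputable section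

namespace WeightedLimit

/-! ### Generalized elements of hom-objects -/

section Calculus

variable {V : Type u} [Category.{v} V] [CartesianMonoidalCategory V]

/-- The composite of two generalized elements `f : X ⟶ C(a, b)` and `g : X ⟶ C(b, c)` of
hom-objects of a `V`-category. -/
def ecmp {C : Type w₁} [EnrichedCategory V C] {X : V} {a b c : C}
    (f : X ⟶ (a ⟶[V] b)) (g : X ⟶ (b ⟶[V] c)) : X ⟶ (a ⟶[V] c) :=
  lift f g ≫ eComp V a b c

/-- The identity of `a`, as a generalized element of `C(a, a)`. -/
def eone {C : Type w₁} [EnrichedCategory V C] (X : V) (a : C) : X ⟶ (a ⟶[V] a) :=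
  toUnit X ≫ eId V a

section

variable {C : Type w₁} [EnrichedCategory V C] {D : Type w₂} [EnrichedCategory V D]
  {X Y : V} {a b c d : C}

theorem comp_ecmp (k : Y ⟶ X) (f : X ⟶ (a ⟶[V] b)) (g : X ⟶ (b ⟶[V] c)) :
    k ≫ ecmp f g = ecmp (k ≫ f) (k ≫ g) := by
  rw [ecmp, ecmp, ← comp_lift, Category.assoc]

theorem comp_eone (k : Y ⟶ X) : k ≫ eone X a = eone Y a := by
  rw [eone, eone, ← Category.assoc, comp_toUnit]

theorem eone_ecmp (f : X ⟶ (a ⟶[V] b)) : ecmp (eone X a) f = f := by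
  have h := congrArg (f ≫ ·) (e_id_comp V a b)
  rw [Category.comp_id] at h
  rw [ecmp, eone]
  conv_rhs => rw [← h]
  simp only [← Category.assoc]
  congr 1
  ext <;> simp

theorem ecmp_eone (f : X ⟶ (a ⟶[V] b)) : ecmp f (eone X b) = f := by
  have h := congrArg (f ≫ ·) (e_comp_id V a b)
  rw [Category.comp_id] at h
  rw [ecmp, eone]
  conv_rhs => rw [← h]
  simp only [← Category.assoc]
  congr 1
  ext <;> simp

theorem ecmp_assoc (f : X ⟶ (a ⟶[V] b)) (g : X ⟶ (b ⟶[V] c)) (h : X ⟶ (c ⟶[V] d)) :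
    ecmp (ecmp f g) h = ecmp f (ecmp g h) := by
  have e := congrArg (lift f (lift g h) ≫ ·) (EnrichedCategory.assoc (V := V) a b c d)
  simp only [← Category.assoc, lift_lift_associator_inv, lift_whiskerRight,
    lift_whiskerLeft] at e
  exact e

theorem ecmp_map (F : EnrichedFunctor V C D) (f : X ⟶ (a ⟶[V] b)) (g : X ⟶ (b ⟶[V] c)) :
    ecmp f g ≫ F.map a c = ecmp (f ≫ F.map a b) (g ≫ F.map b c) := by
  simp [ecmp]

theorem eone_map (F : EnrichedFunctor V C D) :
    eone X a ≫ F.map a a = eone X (F.obj a) := by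
  simp [eone]

theorem eComp_eq_ecmp : eComp V a b c = ecmp (fst _ _) (snd _ _) := by
  simp [ecmp]

theorem eId_eq_eone : eId V a = eone (𝟙_ V) a := by
  have : toUnit (𝟙_ V) = 𝟙 _ := toUnit_unique _ _
  simp [eone, this]

theorem ecmp_op [BraidedCategory V] {C : Type w₁} [EnrichedCategory V C] {X : V}
    {a b c : Cᵒᵖ} (f : X ⟶ EnrichedCategory.Hom a b) (g : X ⟶ EnrichedCategory.Hom b c) :
    ecmp f g = ecmp (C := C) (a := c.unop) (b := b.unop) (c := a.unop) g f := by
  rw [ecmp, eComp_op_eq, ← Category.assoc]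
  erw [lift_braiding_hom]
  rfl

theorem eone_op [BraidedCategory V] {C : Type w₁} [EnrichedCategory V C] {X : V} (a : Cᵒᵖ) :
    eone X a = eone (C := C) X a.unop := rfl

end

/-- To build a `V`-functor it suffices to check the axioms on generalized elements. -/
def mkFunctor {C : Type w₁} [EnrichedCategory V C] {D : Type w₂} [EnrichedCategory V D]
    (obj : C → D) (map : ∀ a b : C, (a ⟶[V] b) ⟶ (obj a ⟶[V] obj b))
    (hid : ∀ (a : C) (X : V), eone X a ≫ map a a = eone X (obj a))
    (hcomp : ∀ (a b c : C) (X : V) (f : X ⟶ (a ⟶[V] b)) (g : X ⟶ (b ⟶[V] c)),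
      ecmp f g ≫ map a c = ecmp (f ≫ map a b) (g ≫ map b c)) :
    EnrichedFunctor V C D where
  obj := obj
  map := map
  map_id a := by rw [eId_eq_eone, hid, ← eId_eq_eone]
  map_comp a b c := by
    rw [eComp_eq_ecmp, hcomp]
    rw [ecmp]
    congr 1
    ext <;> simp

/-- To build a `V`-category it suffices to check the axioms on generalized elements. -/
@[reducible]
def mkCategory (C : Type w₁) (Hom : C → C → V) (one : ∀ a, 𝟙_ V ⟶ Hom a a)
    (comp : ∀ a b c, Hom a b ⊗ Hom b c ⟶ Hom a c)
    (one_comp : ∀ (a b : C) (X : V) (f : X ⟶ Hom a b),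
      lift (toUnit X ≫ one a) f ≫ comp a a b = f)
    (comp_one : ∀ (a b : C) (X : V) (f : X ⟶ Hom a b),
      lift f (toUnit X ≫ one b) ≫ comp a b b = f)
    (assoc : ∀ (a b c d : C) (X : V) (f : X ⟶ Hom a b) (g : X ⟶ Hom b c) (h : X ⟶ Hom c d),
      lift (lift f g ≫ comp a b c) h ≫ comp a c d =
        lift f (lift g h ≫ comp b c d) ≫ comp a b d) :
    EnrichedCategory V C where
  Hom := Hom
  id := one
  comp := comp
  id_comp a b := by
    rw [← one_comp a b _ (𝟙 _), ← Category.assoc]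
    congr 1
    ext <;> simp
  comp_id a b := by
    rw [← comp_one a b _ (𝟙 _), ← Category.assoc]
    congr 1
    ext <;> simp
  assoc a b c d := by
    have h := assoc a b c d _ (fst (Hom a b) (Hom b c ⊗ Hom c d)) (snd _ _ ≫ fst _ _)
      (snd _ _ ≫ snd _ _)
    have h₁ : (α_ (Hom a b) (Hom b c) (Hom c d)).inv ≫ comp a b c ▷ _ =
        lift (lift (fst (Hom a b) (Hom b c ⊗ Hom c d)) (snd _ _ ≫ fst _ _) ≫ comp a b c)
          (snd _ _ ≫ snd _ _) := by
      ext
      · simp only [Category.assoc, whiskerRight_fst, lift_fst]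
        rw [← Category.assoc]
        congr 1
        ext <;> simp
      · simp
    have h₂ : Hom a b ◁ comp b c d =
        lift (fst (Hom a b) (Hom b c ⊗ Hom c d))
          (lift (snd _ _ ≫ fst _ _) (snd _ _ ≫ snd _ _) ≫ comp b c d) := by
      ext
      · simp
      · simp only [whiskerLeft_snd, lift_snd]
        congr 1
        ext <;> simp
    rw [← Category.assoc, h₁, h₂, h]

end Calculus

/-! ### `V` as a `V`-category -/

section Self

variable {V : Type u} [Category.{v} V] [CartesianMonoidalCategory V] [MonoidalClosed V]

/-- The value of a generalized element of an internal hom at a generalized element. -/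
def app {X P Q : V} (f : X ⟶ (ihom P).obj Q) (p : X ⟶ P) : X ⟶ Q :=
  lift p f ≫ (ihom.ev P).app Q

theorem comp_app {X Y P Q : V} (k : Y ⟶ X) (f : X ⟶ (ihom P).obj Q) (p : X ⟶ P) :
    k ≫ app f p = app (k ≫ f) (k ≫ p) := by
  rw [app, app, ← comp_lift, Category.assoc]

theorem app_curry {X P Q R : V} (h : P ⊗ R ⟶ Q) (k : X ⟶ R) (p : X ⟶ P) :
    app (k ≫ curry h) p = lift p k ≫ h := by
  have := uncurry_curry h
  rw [uncurry_eq] at this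
  conv_rhs => rw [← this]
  rw [app, ← Category.assoc]
  congr 1
  ext <;> simp

theorem app_ext {X P Q : V} {f g : X ⟶ (ihom P).obj Q}
    (h : ∀ (Y : V) (k : Y ⟶ X) (p : Y ⟶ P), app (k ≫ f) p = app (k ≫ g) p) : f = g := by
  apply uncurry_injective
  have := h _ (snd P X) (fst P X)
  have e : ∀ f : X ⟶ (ihom P).obj Q, app (snd P X ≫ f) (fst P X) = uncurry f := by
    intro f
    rw [uncurry_eq, app]
    congr 1
    ext <;> simp
  rwa [e, e] at this

theorem app_comp {X P Q R : V} (f : X ⟶ (ihom P).obj Q) (g : X ⟶ (ihom Q).obj R)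
    (p : X ⟶ P) : lift p (lift f g) ≫ compTranspose P Q R = app g (app f p) := by
  rw [compTranspose_eq]
  simp only [← Category.assoc]
  rw [lift_lift_associator_inv, lift_whiskerRight]
  rfl

theorem app_ecmp {X P Q R : V} (f : X ⟶ EnrichedCategory.Hom P Q)
    (g : X ⟶ EnrichedCategory.Hom Q R) (p : X ⟶ P) :
    app (ecmp f g) p = app g (app f p) := by
  have e : eComp V P Q R = curry (compTranspose P Q R) := rfl
  rw [ecmp, e, app_curry]
  exact app_comp f g p

theorem app_eone {X P : V} (p : X ⟶ P) : app (eone X P) p = p := by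
  have e : eId V P = curry (ρ_ P).hom := rfl
  rw [eone, e, app_curry]
  simp

/-- The map `C(b, c) ⟶ [C(a, b), C(a, c)]`, the transpose of the composition of `C`. -/
def postcomp {C : Type w₁} [EnrichedCategory V C] (a b c : C) :
    (b ⟶[V] c) ⟶ (ihom (a ⟶[V] b)).obj (a ⟶[V] c) :=
  curry (eComp V a b c)

/-- The map `C(a, b) ⟶ [C(b, c), C(a, c)]`, the transpose of the composition of `C`. -/
def precomp {C : Type w₁} [EnrichedCategory V C] (a b c : C) :
    (a ⟶[V] b) ⟶ (ihom (b ⟶[V] c)).obj (a ⟶[V] c) :=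
  curry (ecmp (snd _ _) (fst _ _))

theorem app_postcomp {C : Type w₁} [EnrichedCategory V C] {X : V} {a b c : C}
    (f : X ⟶ (b ⟶[V] c)) (p : X ⟶ (a ⟶[V] b)) :
    app (f ≫ postcomp a b c) p = ecmp p f :=
  app_curry _ _ _

theorem app_precomp {C : Type w₁} [EnrichedCategory V C] {X : V} {a b c : C}
    (f : X ⟶ (a ⟶[V] b)) (p : X ⟶ (b ⟶[V] c)) :
    app (f ≫ precomp a b c) p = ecmp f p := by
  rw [precomp, app_curry, comp_ecmp, lift_fst, lift_snd]

/-- The `V`-functor `C(a, -) : C ⥤ V`; its action on hom-objects is the transpose of the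
composition of `C`. -/
def homFrom {C : Type w₁} [EnrichedCategory V C] (a : C) : EnrichedFunctor V C V :=
  mkFunctor (fun b => (a ⟶[V] b)) (fun b c => postcomp a b c)
    (fun b X => app_ext fun Y k p => by
      rw [← Category.assoc, app_postcomp, comp_eone, comp_eone, app_eone]
      exact ecmp_eone p)
    (fun b c d X f g => app_ext fun Y k p => by
      rw [← Category.assoc, app_postcomp, comp_ecmp, comp_ecmp, app_ecmp, ← Category.assoc,
        app_postcomp, ← Category.assoc, app_postcomp]
      exact (ecmp_assoc _ _ _).symm)

end Self

/-! ### `V`-natural transformations -/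

section NatTrans

variable {V : Type u} [Category.{v} V] [CartesianMonoidalCategory V]
  {C : Type w₁} [EnrichedCategory V C] {D : Type w₂} [EnrichedCategory V D]

/-- A `V`-natural transformation `α : F ⇒ G`: maps `α_a : 1 ⟶ D(F a, G a)` such that the
maps `(α_b)_* ∘ F_{a,b}` and `(α_a)^* ∘ G_{a,b}` from `C(a, b)` to `D(F a, G b)` agree. -/
@[ext]
structure VNatTrans (F G : EnrichedFunctor V C D) where
  app : ∀ a : C, 𝟙_ V ⟶ (F.obj a ⟶[V] G.obj a)
  naturality : ∀ a b : C,
    ecmp (F.map a b) (toUnit _ ≫ app b) = ecmp (toUnit _ ≫ app a) (G.map a b)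

namespace VNatTrans

/-- The identity `V`-natural transformation. -/
def id (F : EnrichedFunctor V C D) : VNatTrans F F where
  app a := eId V (F.obj a)
  naturality a b := by
    rw [← eone, ← eone, ecmp_eone, eone_ecmp]

/-- Vertical composition of `V`-natural transformations. -/
def comp {F G H : EnrichedFunctor V C D} (α : VNatTrans F G) (β : VNatTrans G H) :
    VNatTrans F H where
  app a := ecmp (α.app a) (β.app a)
  naturality a b := by
    rw [comp_ecmp, comp_ecmp, ← ecmp_assoc, α.naturality, ecmp_assoc, β.naturality, ecmp_assoc]

/-- `α` is an isomorphism in the category of `V`-functors and `V`-natural transformations. -/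
def IsIso {F G : EnrichedFunctor V C D} (α : VNatTrans F G) : Prop :=
  ∃ β : VNatTrans G F, α.comp β = VNatTrans.id F ∧ β.comp α = VNatTrans.id G

end VNatTrans

end NatTrans

/-! ### The `V`-category of `V`-functors -/

section FunctorCategory

variable {V : Type u} [Category.{v} V] [CartesianMonoidalCategory V] [MonoidalClosed V]

/-- The first of the two parallel maps whose equalizer is the end of `D(F -, G -)`. -/
def natLeft {C : Type w₁} [EnrichedCategory V C] {D : Type w₂} [EnrichedCategory V D]
    [HasProductsOfShape C V] (F G : EnrichedFunctor V C D) :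
    (∏ᶜ fun a : C => (F.obj a ⟶[V] G.obj a)) ⟶
      ∏ᶜ fun a : C => ∏ᶜ fun b : C => (ihom (a ⟶[V] b)).obj (F.obj a ⟶[V] G.obj b) :=
  Pi.lift fun a => Pi.lift fun b => curry (ecmp (fst _ _ ≫ F.map a b) (snd _ _ ≫ Pi.π _ b))

/-- The second of the two parallel maps whose equalizer is the end of `D(F -, G -)`. -/
def natRight {C : Type w₁} [EnrichedCategory V C] {D : Type w₂} [EnrichedCategory V D]
    [HasProductsOfShape C V] (F G : EnrichedFunctor V C D) :
    (∏ᶜ fun a : C => (F.obj a ⟶[V] G.obj a)) ⟶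
      ∏ᶜ fun a : C => ∏ᶜ fun b : C => (ihom (a ⟶[V] b)).obj (F.obj a ⟶[V] G.obj b) :=
  Pi.lift fun a => Pi.lift fun b => curry (ecmp (snd _ _ ≫ Pi.π _ a) (fst _ _ ≫ G.map a b))

theorem natLeft_π {C : Type w₁} [EnrichedCategory V C] {D : Type w₂} [EnrichedCategory V D]
    [HasProductsOfShape C V] (F G : EnrichedFunctor V C D) (a b : C) :
    natLeft F G ≫ Pi.π _ a ≫ Pi.π _ b =
      curry (ecmp (fst _ _ ≫ F.map a b) (snd _ _ ≫ Pi.π _ b)) := by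
  simp [natLeft]

theorem natRight_π {C : Type w₁} [EnrichedCategory V C] {D : Type w₂} [EnrichedCategory V D]
    [HasProductsOfShape C V] (F G : EnrichedFunctor V C D) (a b : C) :
    natRight F G ≫ Pi.π _ a ≫ Pi.π _ b =
      curry (ecmp (snd _ _ ≫ Pi.π (fun c => (F.obj c ⟶[V] G.obj c)) a)
        (fst _ _ ≫ G.map a b)) := by
  simp [natRight]

instance hasEqualizers_of_cartesian [HasPullbacks V] : HasEqualizers V :=
  hasEqualizers_of_hasPullbacks_and_binary_products

variable {C : Type w₁} [EnrichedCategory V C] {D : Type w₂} [EnrichedCategory V D]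
  [HasProductsOfShape C V] [HasPullbacks V]

/-- The object of `V`-natural transformations `F ⇒ G`, i.e. the end `∫_C D(F -, G -)`. -/
abbrev natObj (F G : EnrichedFunctor V C D) : V :=
  equalizer (natLeft F G) (natRight F G)

/-- The projection of the end to its component at `a`. -/
def natProj (F G : EnrichedFunctor V C D) (a : C) : natObj F G ⟶ (F.obj a ⟶[V] G.obj a) :=
  equalizer.ι _ _ ≫ Pi.π _ a

theorem natProj_naturality (F G : EnrichedFunctor V C D) {X : V} (k : X ⟶ natObj F G)
    {a b : C} (f : X ⟶ (a ⟶[V] b)) :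
    ecmp (f ≫ F.map a b) (k ≫ natProj F G b) = ecmp (k ≫ natProj F G a) (f ≫ G.map a b) := by
  have h : k ≫ equalizer.ι _ _ ≫ natLeft F G ≫ Pi.π _ a ≫ Pi.π _ b =
      k ≫ equalizer.ι _ _ ≫ natRight F G ≫ Pi.π _ a ≫ Pi.π _ b := by
    rw [equalizer.condition_assoc]
  rw [natLeft_π, natRight_π] at h
  have h' := congrArg (fun t => app t f) h
  simp only [← Category.assoc, app_curry] at h'
  simpa [comp_ecmp, natProj] using h'

theorem natObj_ext {F G : EnrichedFunctor V C D} {X : V} {k l : X ⟶ natObj F G}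
    (h : ∀ a, k ≫ natProj F G a = l ≫ natProj F G a) : k = l := by
  apply equalizer.hom_ext
  apply Pi.hom_ext
  intro a
  simpa [natProj, Category.assoc] using h a

/-- A natural family of generalized elements defines a generalized element of the end. -/
def natLift (F G : EnrichedFunctor V C D) {X : V} (α : ∀ a, X ⟶ (F.obj a ⟶[V] G.obj a))
    (h : ∀ (a b : C) (Y : V) (k : Y ⟶ X) (f : Y ⟶ (a ⟶[V] b)),
      ecmp (f ≫ F.map a b) (k ≫ α b) = ecmp (k ≫ α a) (f ≫ G.map a b)) :
    X ⟶ natObj F G :=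
  equalizer.lift (Pi.lift α) (by
    apply Pi.hom_ext
    intro a
    apply Pi.hom_ext
    intro b
    simp only [natLeft, natRight, Category.assoc, Pi.lift_π]
    apply app_ext
    intro Y k f
    have := h a b Y k f
    simp only [← Category.assoc, app_curry]
    simpa [comp_ecmp] using this)

theorem natLift_proj (F G : EnrichedFunctor V C D) {X : V}
    (α : ∀ a, X ⟶ (F.obj a ⟶[V] G.obj a)) (h) (a : C) :
    natLift F G α h ≫ natProj F G a = α a := by
  simp [natLift, natProj]

/-- The identity of `F` in the `V`-category of `V`-functors. -/
def natId (F : EnrichedFunctor V C D) : 𝟙_ V ⟶ natObj F F :=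
  natLift F F (fun a => eId V (F.obj a)) (fun a b Y k f => by
    rw [eId_eq_eone, eId_eq_eone, comp_eone, comp_eone, ecmp_eone, eone_ecmp])

/-- The composition of the `V`-category of `V`-functors. -/
def natComp (F G H : EnrichedFunctor V C D) : natObj F G ⊗ natObj G H ⟶ natObj F H :=
  natLift F H
    (fun a => ecmp (fst _ _ ≫ natProj F G a) (snd _ _ ≫ natProj G H a))
    (fun a b Y k f => by
      simp only [comp_ecmp, ← Category.assoc]
      rw [← ecmp_assoc, natProj_naturality, ecmp_assoc, natProj_naturality, ecmp_assoc])

theorem natId_proj (F : EnrichedFunctor V C D) (X : V) (a : C) :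
    (toUnit X ≫ natId F) ≫ natProj F F a = eone X (F.obj a) := by
  rw [Category.assoc, natId, natLift_proj, eone]

theorem natComp_proj (F G H : EnrichedFunctor V C D) {X : V} (f : X ⟶ natObj F G)
    (g : X ⟶ natObj G H) (a : C) :
    (lift f g ≫ natComp F G H) ≫ natProj F H a =
      ecmp (f ≫ natProj F G a) (g ≫ natProj G H a) := by
  rw [Category.assoc, natComp, natLift_proj]
  simp only [comp_ecmp, ← Category.assoc, lift_fst, lift_snd]

/-- The `V`-category `D^C` of `V`-functors `C ⥤ D`; identities and compositions are computed
componentwise. -/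
instance functorCategory : EnrichedCategory V (EnrichedFunctor V C D) :=
  mkCategory (EnrichedFunctor V C D) natObj natId natComp
    (fun F G X f => natObj_ext fun a => by
      rw [natComp_proj, natId_proj, eone_ecmp])
    (fun F G X f => natObj_ext fun a => by
      rw [natComp_proj, natId_proj, ecmp_eone])
    (fun F G H K X f g h => natObj_ext fun a => by
      rw [natComp_proj, natComp_proj, natComp_proj, natComp_proj, ecmp_assoc])

theorem ecmp_natProj {F G H : EnrichedFunctor V C D} {X : V}
    (f : X ⟶ EnrichedCategory.Hom F G) (g : X ⟶ EnrichedCategory.Hom G H) (a : C) :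
    ecmp f g ≫ natProj F H a = ecmp (f ≫ natProj F G a) (g ≫ natProj G H a) :=
  natComp_proj F G H f g a

theorem eone_natProj {F : EnrichedFunctor V C D} {X : V} (a : C) :
    eone X F ≫ natProj F F a = eone X (F.obj a) :=
  natId_proj F X a

/-- The element `1 ⟶ D^C(F, G)` corresponding to a `V`-natural transformation `F ⇒ G`. -/
def VNatTrans.toElement {F G : EnrichedFunctor V C D} (α : VNatTrans F G) :
    𝟙_ V ⟶ (F ⟶[V] G) :=
  natLift F G α.app (fun a b Y k f => by
    have h := congrArg (f ≫ ·) (α.naturality a b)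
    simp only [comp_ecmp, ← Category.assoc] at h
    rwa [toUnit_unique (f ≫ toUnit _) k] at h)

end FunctorCategory

/-! ### Representable `V`-functors and weighted limits -/

section Weighted

variable {V : Type u} [Category.{v} V] [CartesianMonoidalCategory V] [MonoidalClosed V]

theorem app_curry' {X P Q : V} (m : P ⟶ Q) (q : X ⟶ P) (l : X ⟶ 𝟙_ V) :
    app (l ≫ curry' m) q = q ≫ m := by
  rw [curry', app_curry]
  simp

theorem elementNatTrans_naturality {D : Type w₁} [EnrichedCategory V D]
    (F : EnrichedFunctor V D V) (d : D) (x : 𝟙_ V ⟶ F.obj d) (a b : D) :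
    ecmp (a := (d ⟶[V] a)) (b := (d ⟶[V] b)) (c := F.obj b) (postcomp d a b)
      (toUnit (a ⟶[V] b) ≫ curry' (app (F.map d b) (toUnit _ ≫ x))) =
    ecmp (a := (d ⟶[V] a)) (b := F.obj a) (c := F.obj b)
      (toUnit (a ⟶[V] b) ≫ curry' (app (F.map d a) (toUnit _ ≫ x))) (F.map a b) := by
  apply app_ext
  intro Y k p
  rw [comp_ecmp, comp_ecmp, app_ecmp, app_ecmp, ← Category.assoc, ← Category.assoc,
    app_curry', app_curry', app_postcomp, comp_app, comp_app, ecmp_map, app_ecmp]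
  simp only [← Category.assoc]
  rw [toUnit_unique (ecmp p k ≫ toUnit _) (p ≫ toUnit _)]

/-- For a `V`-functor `F : D ⥤ V` and an element `x : 1 ⟶ F d`, the `V`-natural transformation
`D(d, -) ⇒ F` whose component at `e` is the transpose of the map `D(d, e) ⟶ F e` obtained by
evaluating `F_{d,e} : D(d, e) ⟶ [F d, F e]` at `x`. -/
def elementNatTrans {D : Type w₁} [EnrichedCategory V D] (F : EnrichedFunctor V D V) (d : D)
    (x : 𝟙_ V ⟶ F.obj d) : VNatTrans (homFrom d) F where
  app e := curry' (app (F.map d e) (toUnit _ ≫ x))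
  naturality a b := elementNatTrans_naturality F d x a b

/-- A `V`-functor `F : Cᵒᵖ ⥤ V` is represented by `(c, x)`, where `x : 1 ⟶ F c`, if the induced
`V`-natural transformation `C(-, c) ⇒ F` is an isomorphism. -/
def IsRepresentedBy [BraidedCategory V] {C : Type w₁} [EnrichedCategory V C]
    (F : EnrichedFunctor V Cᵒᵖ V) (c : C) (x : 𝟙_ V ⟶ F.obj (op c)) : Prop :=
  (elementNatTrans F (op c) x).IsIso

variable {C : Type w₁} [EnrichedCategory V C] {I : Type w₂} [EnrichedCategory V I]

/-- The `V`-functor `C(a, G -) : I ⥤ V`. -/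
def homInto (G : EnrichedFunctor V I C) (a : C) : EnrichedFunctor V I V :=
  G.comp V (homFrom a)

theorem precomp_naturality (a b c d : C) {Y : V} (k : Y ⟶ (a ⟶[V] b)) (f : Y ⟶ (c ⟶[V] d)) :
    ecmp (a := (b ⟶[V] c)) (b := (b ⟶[V] d)) (c := (a ⟶[V] d))
      (f ≫ postcomp b c d) (k ≫ precomp a b d) =
    ecmp (a := (b ⟶[V] c)) (b := (a ⟶[V] c)) (c := (a ⟶[V] d))
      (k ≫ precomp a b c) (f ≫ postcomp a c d) := by
  apply app_ext
  intro Z l p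
  rw [comp_ecmp, comp_ecmp, app_ecmp, app_ecmp]
  simp only [← Category.assoc]
  rw [app_postcomp, app_postcomp, app_precomp, app_precomp]
  exact (ecmp_assoc _ _ _).symm

theorem eone_precomp (a c : C) {X : V} :
    eone X a ≫ precomp a a c = eone X (a ⟶[V] c) := by
  apply app_ext
  intro Y k p
  rw [← Category.assoc, app_precomp, comp_eone, comp_eone, app_eone]
  exact eone_ecmp p

theorem ecmp_precomp (a b c d : C) {X : V} (f : X ⟶ (a ⟶[V] b)) (g : X ⟶ (b ⟶[V] c)) :
    ecmp f g ≫ precomp a c d =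
      ecmp (a := (c ⟶[V] d)) (b := (b ⟶[V] d)) (c := (a ⟶[V] d))
        (g ≫ precomp b c d) (f ≫ precomp a b d) := by
  apply app_ext
  intro Y k p
  rw [← Category.assoc, app_precomp, comp_ecmp, comp_ecmp, app_ecmp]
  simp only [← Category.assoc]
  rw [app_precomp, app_precomp]
  exact ecmp_assoc _ _ _


theorem homInto_naturality (G : EnrichedFunctor V I C) (a b : C) (i j : I) (Y : V)
    (k : Y ⟶ (a ⟶[V] b)) (f : Y ⟶ (i ⟶[V] j)) :
    ecmp (a := (homInto G b).obj i) (b := (homInto G b).obj j) (c := (homInto G a).obj j)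
      (f ≫ (homInto G b).map i j) (k ≫ precomp a b (G.obj j)) =
    ecmp (a := (homInto G b).obj i) (b := (homInto G a).obj i) (c := (homInto G a).obj j)
      (k ≫ precomp a b (G.obj i)) (f ≫ (homInto G a).map i j) := by
  have h := precomp_naturality a b (G.obj i) (G.obj j) k (f ≫ G.map i j)
  simp only [Category.assoc] at h
  exact h

variable [HasPullbacks V] [HasProductsOfShape I V]

/-- The map `C(a, b) ⟶ V^I(C(b, G -), C(a, G -))` whose component at `i` is the transpose of the
composition map `C(a, b) × C(b, G i) ⟶ C(a, G i)`. -/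
def homIntoMap (G : EnrichedFunctor V I C) (a b : C) :
    (a ⟶[V] b) ⟶ natObj (homInto G b) (homInto G a) :=
  natLift (homInto G b) (homInto G a) (fun i => precomp a b (G.obj i))
    (fun i j Y k f => homInto_naturality G a b i j Y k f)

theorem homIntoMap_proj (G : EnrichedFunctor V I C) (a b : C) (i : I) :
    homIntoMap G a b ≫ natProj _ _ i = precomp a b (G.obj i) :=
  natLift_proj (homInto G b) (homInto G a) (fun i => precomp a b (G.obj i)) _ i

theorem homIntoMap_eone (G : EnrichedFunctor V I C) (a : C) (X : V) (i : I) :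
    (eone X a ≫ homIntoMap G a a) ≫ natProj _ _ i = eone X (a ⟶[V] G.obj i) := by
  rw [Category.assoc, homIntoMap_proj]
  exact eone_precomp a (G.obj i)

theorem homIntoMap_ecmp (G : EnrichedFunctor V I C) (a b c : C) {X : V}
    (f : X ⟶ (a ⟶[V] b)) (g : X ⟶ (b ⟶[V] c)) (i : I) :
    (ecmp f g ≫ homIntoMap G a c) ≫ natProj _ _ i =
      ecmp (a := (homInto G c).obj i) (b := (homInto G b).obj i) (c := (homInto G a).obj i)
        ((g ≫ homIntoMap G b c) ≫ natProj _ _ i) ((f ≫ homIntoMap G a b) ≫ natProj _ _ i) := by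
  rw [Category.assoc, Category.assoc, Category.assoc, homIntoMap_proj, homIntoMap_proj,
    homIntoMap_proj]
  exact ecmp_precomp a b c (G.obj i) f g

variable [BraidedCategory V]

/-- The `V`-functor `C(-, G) : Cᵒᵖ ⥤ V^I`. -/
def homIntoFunctor (G : EnrichedFunctor V I C) :
    EnrichedFunctor V Cᵒᵖ (EnrichedFunctor V I V) :=
  mkFunctor (fun a => homInto G a.unop)
    (fun b a => homIntoMap G a.unop b.unop)
    (fun a X => natObj_ext fun i => by
      rw [eone_natProj]
      exact (homIntoMap_eone G _ X i))
    (fun a b c X f g => natObj_ext fun i => by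
      rw [ecmp_natProj, ecmp_op]
      exact homIntoMap_ecmp G _ _ _ _ _ i)

/-- The `V`-functor `V^I(W, C(-, G)) : Cᵒᵖ ⥤ V`. -/
def coneFunctor (G : EnrichedFunctor V I C) (W : EnrichedFunctor V I V) :
    EnrichedFunctor V Cᵒᵖ V :=
  (homIntoFunctor G).comp V (homFrom W)

/-- The pair `(L, lam)`, where `lam : W ⇒ C(L, G -)`, is a `W`-weighted `V`-limit of `G`: the
`V`-functor `V^I(W, C(-, G))` is represented by `(L, lam)`. -/
def IsWeightedLimit (G : EnrichedFunctor V I C) (W : EnrichedFunctor V I V) (L : C)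
    (lam : VNatTrans W (homInto G L)) : Prop :=
  IsRepresentedBy (coneFunctor G W) L lam.toElement

end Weighted

/-! ### Tensors, conservative families, terminal objects -/

section Misc

variable {V : Type u} [Category.{v} V] [CartesianMonoidalCategory V]

/-- The `V`-category `C` has all `V`-tensors by `X`: for every `c` there are an object `t` and a
map `γ : X ⟶ C(c, t)` such that the map `C(t, a) ⟶ [X, C(c, a)]` induced by `γ` and composition
is an isomorphism for all `a`. -/
def HasTensorsBy [MonoidalClosed V] (X : V) (C : Type w₁) [EnrichedCategory V C] : Prop :=
  ∀ c : C, ∃ (t : C) (γ : X ⟶ (c ⟶[V] t)), ∀ a : C,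
    IsIso (curry (γ ▷ (t ⟶[V] a) ≫ eComp V c t a))

/-- A family of objects of `V` is conservative if a map is an isomorphism if and only if it
induces bijections on generalized elements of every shape in the family. -/
def IsConservative (𝒢 : Set V) : Prop :=
  ∀ ⦃Y Z : V⦄ (f : Y ⟶ Z),
    IsIso f ↔ ∀ X ∈ 𝒢, Function.Bijective (fun g : X ⟶ Y => g ≫ f)

/-- The object `t` of `C` is `V`-terminal: every `C(a, t) ⟶ 1` is an isomorphism. -/
def IsVTerminal {C : Type w₁} [EnrichedCategory V C] (t : C) : Prop :=
  ∀ a : C, IsIso (toUnit (a ⟶[V] t))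

end Misc

/-! ### Extensive categories -/

section Extensivity

/-- The functor `∏ᵢ V / X i ⥤ V / ∐ X` given by coproducts. -/
def sigmaOver {V : Type u} [Category.{v} V] {I : Type w} [HasCoproductsOfShape I V]
    (X : I → V) : (∀ i, Over (X i)) ⥤ Over (∐ X) where
  obj f := Over.mk (Limits.Sigma.map fun i => (f i).hom)
  map g := Over.homMk (Limits.Sigma.map fun i => (g i).left)

/-- `V` is extensive: it has all small coproducts (indexed by types in `Type w`), and for every
small family `X` the functor `∏ᵢ V / X i ⥤ V / ∐ X` is an equivalence of categories. -/
class Extensive (V : Type u) [Category.{v} V] : Prop where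
  hasCoproducts : HasCoproducts.{w} V
  isEquivalence : ∀ {I : Type w} (X : I → V), (sigmaOver X).IsEquivalence

variable {V : Type u} [Category.{v} V]

theorem hasCoproductsOfShape_of_small (V : Type u) [Category.{v} V] [Extensive.{w} V]
    (D : Type w₁) [Small.{w} D] : HasCoproductsOfShape D V :=
  have : HasCoproductsOfShape (Shrink.{w} D) V := Extensive.hasCoproducts (Shrink.{w} D)
  hasColimitsOfShape_of_equivalence (Discrete.equivalence (equivShrink.{w} D).symm)

/-- The coproduct in `V` of a family indexed by a `w`-small type. -/
def sig [Extensive.{w} V] {D : Type w₁} [Small.{w} D] (X : D → V) : V :=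
  haveI := hasCoproductsOfShape_of_small.{w} V D
  ∐ X

/-- The coproduct inclusions. -/
def sigι [Extensive.{w} V] {D : Type w₁} [Small.{w} D] (X : D → V) (d : D) :
    X d ⟶ sig.{w} X :=
  haveI := hasCoproductsOfShape_of_small.{w} V D
  Limits.Sigma.ι X d

/-- The map out of a coproduct induced by a family of maps. -/
def sigDesc [Extensive.{w} V] {D : Type w₁} [Small.{w} D] {X : D → V} {T : V}
    (f : ∀ d, X d ⟶ T) : sig.{w} X ⟶ T :=
  haveI := hasCoproductsOfShape_of_small.{w} V D
  Limits.Sigma.desc f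

section

variable [Extensive.{w} V] {D : Type w₁} [Small.{w} D] {X : D → V}

theorem sigι_desc {T : V} (f : ∀ d, X d ⟶ T) (d : D) : sigι.{w} X d ≫ sigDesc.{w} f = f d := by
  have := hasCoproductsOfShape_of_small.{w} V D
  exact Limits.Sigma.ι_desc f d

theorem sigι_desc_assoc {T U : V} (f : ∀ d, X d ⟶ T) (d : D) (g : T ⟶ U) :
    sigι.{w} X d ≫ sigDesc.{w} f ≫ g = f d ≫ g := by
  rw [← Category.assoc, sigι_desc]

theorem sig_ext {T : V} {f g : sig.{w} X ⟶ T}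
    (h : ∀ d, sigι.{w} X d ≫ f = sigι.{w} X d ≫ g) : f = g := by
  have := hasCoproductsOfShape_of_small.{w} V D
  exact Limits.Sigma.hom_ext _ _ h

end

theorem decompose_aux [Extensive.{w} V] {I : Type w} [HasCoproductsOfShape I V] {X : I → V}
    {Z : V} (f : Z ⟶ ∐ X) :
    ∃ (W : I → V) (a : ∀ i, W i ⟶ Z) (b : ∀ i, W i ⟶ X i),
      (∀ i, a i ≫ f = b i ≫ Limits.Sigma.ι X i) ∧ Nonempty (IsColimit (Cofan.mk Z a)) := by
  have := Extensive.isEquivalence.{w} X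
  let P := (sigmaOver X).objPreimage (Over.mk f)
  let e : (sigmaOver X).obj P ≅ Over.mk f := (sigmaOver X).objObjPreimageIso (Over.mk f)
  let e' : (∐ fun i => (P i).left) ≅ Z := (Over.forget _).mapIso e
  have he : e'.hom ≫ f = Limits.Sigma.map fun i => (P i).hom := Over.w e.hom
  refine ⟨fun i => (P i).left, fun i => Limits.Sigma.ι (fun i => (P i).left) i ≫ e'.hom, fun i => (P i).hom,
    fun i => ?_, ⟨?_⟩⟩
  · rw [Category.assoc, he]
    simp
  · refine IsColimit.ofIsoColimit (coproductIsCoproduct fun i => (P i).left)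
      (Cofan.ext e' fun i => ?_)
    simp

theorem disjoint_aux [Extensive.{w} V] {I : Type w} [HasCoproductsOfShape I V] {X : I → V}
    {Z : V} {i j : I} (x : Z ⟶ X i) (y : Z ⟶ X j)
    (h : x ≫ Limits.Sigma.ι X i = y ≫ Limits.Sigma.ι X j) :
    (∀ e : i = j, x ≫ eqToHom (congrArg X e) = y) ∧
      (i ≠ j → ∀ B : V, IsInitial B → Nonempty (Z ⟶ B)) := by
  have := Extensive.isEquivalence.{w} X
  have : ∀ J : Type w, HasCoproductsOfShape J V := Extensive.hasCoproducts
  let P : ∀ (k : I) (_ : Z ⟶ X k) (l : I), Over (X l) := fun k z l =>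
    Over.mk (Limits.Sigma.desc fun p : ULift.{w} (PLift (l = k)) =>
      z ≫ eqToHom (congrArg X p.down.down.symm))
  let r : ∀ (k : I) (z : Z ⟶ X k), (∐ fun l => (P k z l).left) ⟶ Z := fun k z =>
    Limits.Sigma.desc fun l => Limits.Sigma.desc fun _ => 𝟙 Z
  let c : ∀ (k : I) (z : Z ⟶ X k), Z ⟶ (P k z k).left := fun k z =>
    Limits.Sigma.ι (fun _ : ULift.{w} (PLift (k = k)) => Z) ⟨⟨rfl⟩⟩
  have hcr : ∀ (k : I) (z : Z ⟶ X k),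
      c k z ≫ Limits.Sigma.ι (fun l => (P k z l).left) k ≫ r k z = 𝟙 Z := by
    intro k z
    simp [c, r, P]
  have hc : ∀ (k : I) (z : Z ⟶ X k), c k z ≫ (P k z k).hom = z := by
    intro k z
    simp [c, P]
  let m' : (sigmaOver X).obj (P i x) ⟶ (sigmaOver X).obj (P j y) :=
    Over.homMk (r i x ≫ c j y ≫ Limits.Sigma.ι (fun l => (P j y l).left) j) (by
      apply Limits.Sigma.hom_ext
      intro l
      apply Limits.Sigma.hom_ext
      rintro ⟨⟨rfl⟩⟩
      have h₁ : (((sigmaOver X).obj (P j y)).hom) =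
        Limits.Sigma.map fun l => (P j y l).hom := rfl
      have h₂ : (((sigmaOver X).obj (P l x)).hom) =
        Limits.Sigma.map fun k => (P l x k).hom := rfl
      rw [h₁, h₂]
      rw [Limits.Sigma.ι_map]
      have h₃ := hcr l x
      have h₄ := hc l x
      change c l x ≫ Limits.Sigma.ι (fun k => (P l x k).left) l ≫
        (r l x ≫ c j y ≫ Limits.Sigma.ι (fun k => (P j y k).left) j) ≫
        Limits.Sigma.map (fun k => (P j y k).hom) = c l x ≫ (P l x l).hom ≫ Limits.Sigma.ι X l
      rw [← Category.assoc (c l x) (P l x l).hom, h₄, h]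
      simp only [Category.assoc, Limits.Sigma.ι_map]
      rw [← Category.assoc (c j y) (P j y j).hom, hc]
      have := congrArg (· ≫ y ≫ Limits.Sigma.ι X j) h₃
      simpa only [Category.assoc, Category.id_comp] using this)
  let m := (sigmaOver X).preimage m'
  have hm : (sigmaOver X).map m = m' := (sigmaOver X).map_preimage m'
  have hm₂ : Limits.Sigma.map (fun l => (m l).left) =
      r i x ≫ c j y ≫ Limits.Sigma.ι (fun l => (P j y l).left) j :=
    congrArg (fun t => t.left) hm
  constructor
  · rintro rfl
    have h₁ := congrArg (fun t => c i x ≫ Limits.Sigma.ι (fun l => (P i x l).left) i ≫ t ≫ r i y)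
      hm₂
    have h₂ : c i x ≫ (m i).left ≫ Limits.Sigma.ι (fun l => (P i y l).left) i ≫ r i y = 𝟙 Z := by
      simpa only [Limits.Sigma.ι_map_assoc, Category.assoc, hcr, Category.comp_id] using h₁
    have h₃ : Limits.Sigma.ι (fun l => (P i y l).left) i ≫ r i y ≫ y = (P i y i).hom := by
      simp only [r, P, Limits.Sigma.ι_desc_assoc]
      apply Limits.Sigma.hom_ext
      rintro ⟨⟨_⟩⟩
      simp
    have h₄ : (m i).left ≫ (P i y i).hom = (P i x i).hom := Over.w (m i)
    have h₅ := congrArg (· ≫ y) h₂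
    simp only [Category.assoc, h₃, h₄, hc, Category.id_comp] at h₅
    simpa using h₅
  · intro hij B hB
    exact ⟨c i x ≫ (m i).left ≫ Limits.Sigma.desc fun p => (hij p.down.down).elim⟩


section

variable [Extensive.{w} V] {D : Type w₁} [Small.{w} D]

/-- Comparison of `sig` with a coproduct indexed by a type in `Type w`. -/
theorem exists_reindex (X : D → V) [HasCoproductsOfShape (Shrink.{w} D) V] :
    ∃ e : (∐ fun i => X ((equivShrink.{w} D).symm i)) ≅ sig.{w} X,
      ∀ i, Limits.Sigma.ι (fun i => X ((equivShrink.{w} D).symm i)) i ≫ e.hom =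
        sigι.{w} X ((equivShrink.{w} D).symm i) := by
  have := hasCoproductsOfShape_of_small.{w} V D
  exact ⟨Limits.Sigma.reindex (equivShrink.{w} D).symm X, fun i =>
    Limits.Sigma.ι_reindex_hom (equivShrink.{w} D).symm X i⟩

variable {X : D → V}

theorem sig_cover {Z : V} (f : Z ⟶ sig.{w} X) :
    ∃ (J : Type w) (k : J → D) (W : J → V) (a : ∀ j, W j ⟶ Z) (b : ∀ j, W j ⟶ X (k j)),
      (∀ j, a j ≫ f = b j ≫ sigι.{w} X (k j)) ∧ Nonempty (IsColimit (Cofan.mk Z a)) := by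
  have : HasCoproductsOfShape (Shrink.{w} D) V := Extensive.hasCoproducts (Shrink.{w} D)
  obtain ⟨e, he⟩ := exists_reindex.{w} X
  obtain ⟨W, a, b, h, hc⟩ := decompose_aux.{w} (f ≫ e.inv)
  refine ⟨Shrink.{w} D, (equivShrink.{w} D).symm, W, a, b, fun j => ?_, hc⟩
  rw [← he, ← Category.assoc, ← h]
  simp

/-- Maps out of `Z` can be compared locally with respect to a map `f` from `Z` to a coproduct. -/
theorem sig_glue_unique {Z T : V} (f : Z ⟶ sig.{w} X) {g h : Z ⟶ T}
    (H : ∀ (Y : V) (d : D) (a : Y ⟶ Z) (b : Y ⟶ X d), a ≫ f = b ≫ sigι.{w} X d →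
      a ≫ g = a ≫ h) : g = h := by
  obtain ⟨J, k, W, a, b, e, ⟨hc⟩⟩ := sig_cover f
  exact Cofan.IsColimit.hom_ext hc _ _ fun j => H _ _ (a j) (b j) (e j)

/-- Maps out of `Z` can be lifted locally with respect to a map `f` from `Z` to a coproduct. -/
theorem sig_glue_exists {Z T U : V} (f : Z ⟶ sig.{w} X) (p : T ⟶ U) (q : Z ⟶ U)
    (H : ∀ (Y : V) (d : D) (a : Y ⟶ Z) (b : Y ⟶ X d), a ≫ f = b ≫ sigι.{w} X d →
      ∃ l : Y ⟶ T, l ≫ p = a ≫ q) : ∃ l : Z ⟶ T, l ≫ p = q := by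
  obtain ⟨J, k, W, a, b, e, ⟨hc⟩⟩ := sig_cover f
  choose l hl using fun j => H _ _ (a j) (b j) (e j)
  refine ⟨Cofan.IsColimit.desc hc l, Cofan.IsColimit.hom_ext hc _ _ fun j => ?_⟩
  have := Cofan.IsColimit.fac hc l j
  change a j ≫ _ = _ at this
  change a j ≫ _ = a j ≫ _
  rw [← Category.assoc, this, hl]

theorem sig_disjoint {Z : V} {i j : D} (x : Z ⟶ X i) (y : Z ⟶ X j)
    (h : x ≫ sigι.{w} X i = y ≫ sigι.{w} X j) :
    (∀ e : i = j, x ≫ eqToHom (congrArg X e) = y) ∧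
      (i ≠ j → ∀ B : V, IsInitial B → Nonempty (Z ⟶ B)) := by
  have : HasCoproductsOfShape (Shrink.{w} D) V := Extensive.hasCoproducts (Shrink.{w} D)
  obtain ⟨e, he⟩ := exists_reindex.{w} X
  obtain ⟨i, rfl⟩ := (equivShrink.{w} D).symm.surjective i
  obtain ⟨j, rfl⟩ := (equivShrink.{w} D).symm.surjective j
  rw [← he, ← he, ← Category.assoc, ← Category.assoc, cancel_mono] at h
  obtain ⟨h₁, h₂⟩ := disjoint_aux.{w} (X := fun i => X ((equivShrink.{w} D).symm i)) x y h
  exact ⟨fun e => h₁ ((equivShrink.{w} D).symm.injective e), fun n => h₂ fun e => n (e ▸ rfl)⟩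

theorem sig_mono_of_eq {Z : V} {i : D} (x y : Z ⟶ X i)
    (h : x ≫ sigι.{w} X i = y ≫ sigι.{w} X i) : x = y := by
  simpa using (sig_disjoint x y h).1 rfl

theorem sig_ne {Z : V} [CartesianMonoidalCategory V] [MonoidalClosed V] {i j : D}
    (x : Z ⟶ X i) (y : Z ⟶ X j) (h : x ≫ sigι.{w} X i = y ≫ sigι.{w} X j) (n : i ≠ j) (T : V) :
    Nonempty (Unique (Z ⟶ T)) := by
  have : HasCoproductsOfShape PEmpty.{w + 1} V := Extensive.hasCoproducts PEmpty.{w + 1}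
  have : HasInitial V := hasColimitsOfShape_of_equivalence
    (Discrete.equivalence (Equiv.equivPEmpty.{w + 1} PEmpty.{1}).symm)
  obtain ⟨k⟩ := (sig_disjoint x y h).2 n _ initialIsInitial
  have := CategoryTheory.strict_initial initialIsInitial k
  exact ⟨⟨⟨k ≫ initial.to T⟩, fun g => by
    rw [← cancel_epi (inv k)]
    exact initial.hom_ext _ _⟩⟩

end

end Extensivity

/-! ### Internal categories -/

section Internal

/-- A category internal to `V`: objects `obj` and `mor`, source, target and identity maps, a
pullback `pairs` of `tgt` and `src` (the object of composable pairs) and a composition map `comp`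
out of it. The unit and associativity laws are stated on generalized elements; a generalized
element of `pairs` is a composable pair of generalized elements of `mor`. -/
structure InternalCat (V : Type u) [Category.{v} V] where
  obj : V
  mor : V
  src : mor ⟶ obj
  tgt : mor ⟶ obj
  idn : obj ⟶ mor
  pairs : V
  pfst : pairs ⟶ mor
  psnd : pairs ⟶ mor
  isPullback : IsPullback pfst psnd tgt src
  comp : pairs ⟶ mor
  idn_src : idn ≫ src = 𝟙 obj
  idn_tgt : idn ≫ tgt = 𝟙 obj
  comp_src : comp ≫ src = pfst ≫ src
  comp_tgt : comp ≫ tgt = psnd ≫ tgt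
  idn_comp : ∀ ⦃X : V⦄ (f : X ⟶ mor) (h : (f ≫ src ≫ idn) ≫ tgt = f ≫ src),
    isPullback.lift (f ≫ src ≫ idn) f h ≫ comp = f
  comp_idn : ∀ ⦃X : V⦄ (f : X ⟶ mor) (h : f ≫ tgt = (f ≫ tgt ≫ idn) ≫ src),
    isPullback.lift f (f ≫ tgt ≫ idn) h ≫ comp = f
  assoc : ∀ ⦃X : V⦄ (f g k : X ⟶ mor) (h₁ : f ≫ tgt = g ≫ src) (h₂ : g ≫ tgt = k ≫ src)
    (h₃ : (isPullback.lift f g h₁ ≫ comp) ≫ tgt = k ≫ src)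
    (h₄ : f ≫ tgt = (isPullback.lift g k h₂ ≫ comp) ≫ src),
    isPullback.lift (isPullback.lift f g h₁ ≫ comp) k h₃ ≫ comp =
      isPullback.lift f (isPullback.lift g k h₂ ≫ comp) h₄ ≫ comp

namespace InternalCat

variable {V : Type u} [Category.{v} V] (A : InternalCat V)

/-- The composite of a composable pair of generalized elements of `A.mor`. -/
def cmp {X : V} (f g : X ⟶ A.mor) (h : f ≫ A.tgt = g ≫ A.src) : X ⟶ A.mor :=
  A.isPullback.lift f g h ≫ A.comp

variable {X Y : V}

theorem cmp_congr {f f' g g' : X ⟶ A.mor} (hf : f = f') (hg : g = g')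
    (h : f ≫ A.tgt = g ≫ A.src) : A.cmp f g h = A.cmp f' g' (by rw [← hf, ← hg, h]) := by
  subst hf hg
  rfl

theorem comp_cmp (k : Y ⟶ X) (f g : X ⟶ A.mor) (h : f ≫ A.tgt = g ≫ A.src) :
    k ≫ A.cmp f g h = A.cmp (k ≫ f) (k ≫ g) (by simp only [Category.assoc, h]) := by
  rw [cmp, cmp, ← Category.assoc]
  congr 1
  apply A.isPullback.hom_ext <;> simp

theorem cmp_src (f g : X ⟶ A.mor) (h : f ≫ A.tgt = g ≫ A.src) :
    A.cmp f g h ≫ A.src = f ≫ A.src := by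
  rw [cmp, Category.assoc, A.comp_src, IsPullback.lift_fst_assoc]

theorem cmp_tgt (f g : X ⟶ A.mor) (h : f ≫ A.tgt = g ≫ A.src) :
    A.cmp f g h ≫ A.tgt = g ≫ A.tgt := by
  rw [cmp, Category.assoc, A.comp_tgt, IsPullback.lift_snd_assoc]

theorem idn_cmp (f : X ⟶ A.mor) (h : (f ≫ A.src ≫ A.idn) ≫ A.tgt = f ≫ A.src) :
    A.cmp (f ≫ A.src ≫ A.idn) f h = f :=
  A.idn_comp f h

theorem cmp_idn (f : X ⟶ A.mor) (h : f ≫ A.tgt = (f ≫ A.tgt ≫ A.idn) ≫ A.src) :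
    A.cmp f (f ≫ A.tgt ≫ A.idn) h = f :=
  A.comp_idn f h

theorem idn_cmp_of_eq {f g : X ⟶ A.mor} (e : f = g ≫ A.src ≫ A.idn)
    (h : f ≫ A.tgt = g ≫ A.src) : A.cmp f g h = g := by
  subst e
  exact A.idn_comp g h

theorem cmp_idn_of_eq {f g : X ⟶ A.mor} (e : g = f ≫ A.tgt ≫ A.idn)
    (h : f ≫ A.tgt = g ≫ A.src) : A.cmp f g h = f := by
  subst e
  exact A.comp_idn f h

theorem cmp_assoc (f g k : X ⟶ A.mor) (h₁ : f ≫ A.tgt = g ≫ A.src)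
    (h₂ : g ≫ A.tgt = k ≫ A.src) (h₃ : A.cmp f g h₁ ≫ A.tgt = k ≫ A.src)
    (h₄ : f ≫ A.tgt = A.cmp g k h₂ ≫ A.src) :
    A.cmp (A.cmp f g h₁) k h₃ = A.cmp f (A.cmp g k h₂) h₄ :=
  A.assoc f g k h₁ h₂ h₃ h₄

theorem ofElements_key {V : Type u} [Category.{v} V] [HasPullbacks V] {obj mor : V}
    (src tgt : mor ⟶ obj) (op : ∀ (X : V) (f g : X ⟶ mor), f ≫ tgt = g ≫ src → (X ⟶ mor))
    (nat : ∀ (X Y : V) (k : Y ⟶ X) (f g : X ⟶ mor) (h : f ≫ tgt = g ≫ src)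
      (h' : (k ≫ f) ≫ tgt = (k ≫ g) ≫ src), k ≫ op X f g h = op Y (k ≫ f) (k ≫ g) h')
    {X : V} (f g : X ⟶ mor) (h : f ≫ tgt = g ≫ src) :
    (IsPullback.of_hasPullback tgt src).lift f g h ≫
      op _ (pullback.fst tgt src) (pullback.snd tgt src) pullback.condition = op X f g h := by
  have h' : ((IsPullback.of_hasPullback tgt src).lift f g h ≫ pullback.fst tgt src) ≫ tgt =
      ((IsPullback.of_hasPullback tgt src).lift f g h ≫ pullback.snd tgt src) ≫ src := by
    simpa using h
  rw [nat _ _ _ _ _ _ h']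
  congr 1 <;> simp

/-- An internal category whose object of composable pairs is the chosen pullback and whose
composition is given by a natural operation on generalized elements. -/
def ofElements {V : Type u} [Category.{v} V] [HasPullbacks V] (obj mor : V) (src tgt : mor ⟶ obj)
    (idn : obj ⟶ mor) (idn_src : idn ≫ src = 𝟙 obj) (idn_tgt : idn ≫ tgt = 𝟙 obj)
    (op : ∀ (X : V) (f g : X ⟶ mor), f ≫ tgt = g ≫ src → (X ⟶ mor))
    (nat : ∀ (X Y : V) (k : Y ⟶ X) (f g : X ⟶ mor) (h : f ≫ tgt = g ≫ src)
      (h' : (k ≫ f) ≫ tgt = (k ≫ g) ≫ src), k ≫ op X f g h = op Y (k ≫ f) (k ≫ g) h')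
    (op_src : ∀ (X : V) (f g : X ⟶ mor) (h : f ≫ tgt = g ≫ src), op X f g h ≫ src = f ≫ src)
    (op_tgt : ∀ (X : V) (f g : X ⟶ mor) (h : f ≫ tgt = g ≫ src), op X f g h ≫ tgt = g ≫ tgt)
    (idn_op : ∀ (X : V) (f : X ⟶ mor) (h : (f ≫ src ≫ idn) ≫ tgt = f ≫ src),
      op X (f ≫ src ≫ idn) f h = f)
    (op_idn : ∀ (X : V) (f : X ⟶ mor) (h : f ≫ tgt = (f ≫ tgt ≫ idn) ≫ src),
      op X f (f ≫ tgt ≫ idn) h = f)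
    (op_assoc : ∀ (X : V) (f g k : X ⟶ mor) (h₁ : f ≫ tgt = g ≫ src) (h₂ : g ≫ tgt = k ≫ src)
      (h₃ : op X f g h₁ ≫ tgt = k ≫ src) (h₄ : f ≫ tgt = op X g k h₂ ≫ src),
      op X (op X f g h₁) k h₃ = op X f (op X g k h₂) h₄) :
    InternalCat V :=
  { obj := obj
    mor := mor
    src := src
    tgt := tgt
    idn := idn
    pairs := pullback tgt src
    pfst := pullback.fst tgt src
    psnd := pullback.snd tgt src
    isPullback := IsPullback.of_hasPullback tgt src
    comp := op _ (pullback.fst tgt src) (pullback.snd tgt src) pullback.condition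
    idn_src := idn_src
    idn_tgt := idn_tgt
    comp_src := op_src _ _ _ _
    comp_tgt := op_tgt _ _ _ _
    idn_comp := fun X f h => by
      rw [ofElements_key src tgt op nat, idn_op]
    comp_idn := fun X f h => by
      rw [ofElements_key src tgt op nat, op_idn]
    assoc := fun X f g k h₁ h₂ h₃ h₄ => by
      simp only [ofElements_key src tgt op nat] at h₃ h₄ ⊢
      exact op_assoc X f g k h₁ h₂ h₃ h₄ }

end InternalCat

/-- An internal functor. Compatibility with composition is stated on generalized elements. -/
structure InternalFunctor {V : Type u} [Category.{v} V] (A B : InternalCat V) where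
  obj : A.obj ⟶ B.obj
  mor : A.mor ⟶ B.mor
  mor_src : mor ≫ B.src = A.src ≫ obj
  mor_tgt : mor ≫ B.tgt = A.tgt ≫ obj
  idn_mor : A.idn ≫ mor = obj ≫ B.idn
  cmp_mor : ∀ ⦃X : V⦄ (f g : X ⟶ A.mor) (h : f ≫ A.tgt = g ≫ A.src)
    (h' : (f ≫ mor) ≫ B.tgt = (g ≫ mor) ≫ B.src),
    A.cmp f g h ≫ mor = B.cmp (f ≫ mor) (g ≫ mor) h'

end Internal

/-! ### The internal category of a small `V`-category -/

theorem eq_of_nonempty_unique {V : Type u} [Category.{v} V] {Z T : V} (h : ∀ T : V, Nonempty (Unique (Z ⟶ T)))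
    (f g : Z ⟶ T) : f = g := by
  obtain ⟨_⟩ := h T
  exact Subsingleton.elim f g

section Internalization

variable {V : Type u} [Category.{v} V] [CartesianMonoidalCategory V] [Extensive.{w} V]
  (D : Type w₁) [EnrichedCategory V D] [Small.{w} D]

/-- The object of objects, `∐_A 1`. -/
def intObj : V := sig.{w} fun _ : D => 𝟙_ V

/-- The object of morphisms, `∐_{A, B} D(A, B)`. -/
def intMor : V := sig.{w} fun p : D × D => (p.1 ⟶[V] p.2)

/-- The object of composable pairs, `∐_{A, B, C} D(A, B) × D(B, C)`. -/
def intPairs : V :=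
  sig.{w} fun p : D × D × D => (p.1 ⟶[V] p.2.1) ⊗ (p.2.1 ⟶[V] p.2.2)

/-- The object `a` of `D`, as an element of `∐_A 1`. -/
def intEl (a : D) : 𝟙_ V ⟶ intObj.{w} (V := V) D := sigι.{w} (fun _ : D => 𝟙_ V) a

/-- The inclusion of `D(a, b)` into `∐_{A, B} D(A, B)`. -/
def intι (a b : D) : (a ⟶[V] b) ⟶ intMor.{w} (V := V) D :=
  sigι.{w} (fun p : D × D => (p.1 ⟶[V] p.2)) (a, b)

/-- The inclusion of `D(a, b) × D(b, c)` into `∐_{A, B, C} D(A, B) × D(B, C)`. -/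
def intιp (a b c : D) : (a ⟶[V] b) ⊗ (b ⟶[V] c) ⟶ intPairs.{w} (V := V) D :=
  sigι.{w} (fun p : D × D × D => (p.1 ⟶[V] p.2.1) ⊗ (p.2.1 ⟶[V] p.2.2)) (a, b, c)

/-- The source map. -/
def intSrc : intMor.{w} (V := V) D ⟶ intObj.{w} (V := V) D :=
  sigDesc.{w} fun p => toUnit _ ≫ intEl.{w} D p.1

/-- The target map. -/
def intTgt : intMor.{w} (V := V) D ⟶ intObj.{w} (V := V) D :=
  sigDesc.{w} fun p => toUnit _ ≫ intEl.{w} D p.2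

/-- The identity map. -/
def intIdn : intObj.{w} (V := V) D ⟶ intMor.{w} (V := V) D :=
  sigDesc.{w} fun a => eId V a ≫ intι.{w} D a a

/-- The first projection from the object of composable pairs. -/
def intFst : intPairs.{w} (V := V) D ⟶ intMor.{w} (V := V) D :=
  sigDesc.{w} fun p => fst _ _ ≫ intι.{w} D p.1 p.2.1

/-- The second projection from the object of composable pairs. -/
def intSnd : intPairs.{w} (V := V) D ⟶ intMor.{w} (V := V) D :=
  sigDesc.{w} fun p => snd _ _ ≫ intι.{w} D p.2.1 p.2.2

/-- The composition map. -/
def intComp : intPairs.{w} (V := V) D ⟶ intMor.{w} (V := V) D :=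
  sigDesc.{w} fun p => eComp V _ _ _ ≫ intι.{w} D p.1 p.2.2

section

variable {D} {X : V} {a b c : D}

theorem intι_src (f : X ⟶ (a ⟶[V] b)) :
    f ≫ intι.{w} D a b ≫ intSrc.{w} D = toUnit X ≫ intEl.{w} D a := by
  have h : intι.{w} D a b ≫ intSrc.{w} D = toUnit _ ≫ intEl.{w} D a :=
    sigι_desc.{w} (fun p : D × D => toUnit (p.1 ⟶[V] p.2) ≫ intEl.{w} D p.1) (a, b)
  rw [h, ← Category.assoc, comp_toUnit]

theorem intι_tgt (f : X ⟶ (a ⟶[V] b)) :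
    f ≫ intι.{w} D a b ≫ intTgt.{w} D = toUnit X ≫ intEl.{w} D b := by
  have h : intι.{w} D a b ≫ intTgt.{w} D = toUnit _ ≫ intEl.{w} D b :=
    sigι_desc.{w} (fun p : D × D => toUnit (p.1 ⟶[V] p.2) ≫ intEl.{w} D p.2) (a, b)
  rw [h, ← Category.assoc, comp_toUnit]

theorem intEl_idn : intEl.{w} D a ≫ intIdn.{w} D = eId V a ≫ intι.{w} D a a :=
  sigι_desc.{w} (fun a : D => eId V a ≫ intι.{w} D a a) a

theorem intιp_fst (f : X ⟶ (a ⟶[V] b)) (g : X ⟶ (b ⟶[V] c)) :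
    (lift f g ≫ intιp.{w} D a b c) ≫ intFst.{w} D = f ≫ intι.{w} D a b := by
  have h : intιp.{w} D a b c ≫ intFst.{w} D = fst _ _ ≫ intι.{w} D a b :=
    sigι_desc.{w} (fun p : D × D × D =>
      fst (p.1 ⟶[V] p.2.1) (p.2.1 ⟶[V] p.2.2) ≫ intι.{w} D p.1 p.2.1) (a, b, c)
  rw [Category.assoc, h, lift_fst_assoc]

theorem intιp_snd (f : X ⟶ (a ⟶[V] b)) (g : X ⟶ (b ⟶[V] c)) :
    (lift f g ≫ intιp.{w} D a b c) ≫ intSnd.{w} D = g ≫ intι.{w} D b c := by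
  have h : intιp.{w} D a b c ≫ intSnd.{w} D = snd _ _ ≫ intι.{w} D b c :=
    sigι_desc.{w} (fun p : D × D × D =>
      snd (p.1 ⟶[V] p.2.1) (p.2.1 ⟶[V] p.2.2) ≫ intι.{w} D p.2.1 p.2.2) (a, b, c)
  rw [Category.assoc, h, lift_snd_assoc]

theorem intιp_comp (f : X ⟶ (a ⟶[V] b)) (g : X ⟶ (b ⟶[V] c)) :
    (lift f g ≫ intιp.{w} D a b c) ≫ intComp.{w} D = ecmp f g ≫ intι.{w} D a c := by
  have h : intιp.{w} D a b c ≫ intComp.{w} D = eComp V a b c ≫ intι.{w} D a c :=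
    sigι_desc.{w} (fun p : D × D × D => eComp V p.1 p.2.1 p.2.2 ≫ intι.{w} D p.1 p.2.2) (a, b, c)
  rw [Category.assoc, h, ecmp, Category.assoc]

theorem intObj_ext {D : Type w₁} [Small.{w} D] {T : V} {f g : intObj.{w} (V := V) D ⟶ T}
    (h : ∀ a : D, intEl.{w} D a ≫ f = intEl.{w} D a ≫ g) : f = g :=
  sig_ext h

theorem intMor_ext {T : V} {f g : intMor.{w} (V := V) D ⟶ T}
    (h : ∀ a b : D, intι.{w} D a b ≫ f = intι.{w} D a b ≫ g) : f = g :=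
  sig_ext fun p => h p.1 p.2

theorem intPairs_ext {T : V} {f g : intPairs.{w} (V := V) D ⟶ T}
    (h : ∀ a b c : D, intιp.{w} D a b c ≫ f = intιp.{w} D a b c ≫ g) : f = g :=
  sig_ext fun p => h p.1 p.2.1 p.2.2

theorem intMor_glue {Z T : V} (f : Z ⟶ intMor.{w} (V := V) D) {g h : Z ⟶ T}
    (H : ∀ (Y : V) (a b : D) (k : Y ⟶ Z) (x : Y ⟶ (a ⟶[V] b)), k ≫ f = x ≫ intι.{w} D a b →
      k ≫ g = k ≫ h) : g = h :=
  sig_glue_unique f fun Y p k x e => H Y p.1 p.2 k x e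

theorem intMor_glue_exists {Z T U : V} (f : Z ⟶ intMor.{w} (V := V) D) (p : T ⟶ U) (q : Z ⟶ U)
    (H : ∀ (Y : V) (a b : D) (k : Y ⟶ Z) (x : Y ⟶ (a ⟶[V] b)), k ≫ f = x ≫ intι.{w} D a b →
      ∃ l : Y ⟶ T, l ≫ p = k ≫ q) : ∃ l : Z ⟶ T, l ≫ p = q :=
  sig_glue_exists f p q fun Y p k x e => H Y p.1 p.2 k x e

theorem intPairs_glue {Z T : V} (f : Z ⟶ intPairs.{w} (V := V) D) {g h : Z ⟶ T}
    (H : ∀ (Y : V) (a b c : D) (k : Y ⟶ Z) (x : Y ⟶ (a ⟶[V] b)) (y : Y ⟶ (b ⟶[V] c)),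
      k ≫ f = lift x y ≫ intιp.{w} D a b c → k ≫ g = k ≫ h) : g = h :=
  sig_glue_unique f fun Y p k x e => H Y p.1 p.2.1 p.2.2 k (x ≫ fst _ _) (x ≫ snd _ _) (by
    refine e.trans ?_
    rw [← comp_lift, lift_fst_snd, Category.comp_id]
    rfl)

theorem intι_inj {Z : V} {x x' : Z ⟶ (a ⟶[V] b)}
    (h : x ≫ intι.{w} D a b = x' ≫ intι.{w} D a b) : x = x' :=
  sig_mono_of_eq (X := fun p : D × D => (p.1 ⟶[V] p.2)) (i := (a, b)) x x' h

theorem int_idn_src : intIdn.{w} D ≫ intSrc.{w} D = 𝟙 (intObj.{w} (V := V) D) := by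
  apply intObj_ext
  intro a
  rw [← Category.assoc, intEl_idn, Category.assoc, intι_src, Category.comp_id,
    toUnit_unique (toUnit (𝟙_ V)) (𝟙 _), Category.id_comp]

theorem int_idn_tgt : intIdn.{w} D ≫ intTgt.{w} D = 𝟙 (intObj.{w} (V := V) D) := by
  apply intObj_ext
  intro a
  rw [← Category.assoc, intEl_idn, Category.assoc, intι_tgt, Category.comp_id,
    toUnit_unique (toUnit (𝟙_ V)) (𝟙 _), Category.id_comp]

theorem int_src_idn {X : V} {a b : D} (x : X ⟶ (a ⟶[V] b)) :
    (x ≫ intι.{w} D a b) ≫ intSrc.{w} D ≫ intIdn.{w} D = eone X a ≫ intι.{w} D a a := by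
  have := intι_src.{w} x
  rw [Category.assoc, ← Category.assoc _ (intSrc.{w} D), ← Category.assoc, this, Category.assoc,
    intEl_idn, eone, Category.assoc]

theorem int_tgt_idn {X : V} {a b : D} (x : X ⟶ (a ⟶[V] b)) :
    (x ≫ intι.{w} D a b) ≫ intTgt.{w} D ≫ intIdn.{w} D = eone X b ≫ intι.{w} D b b := by
  have := intι_tgt.{w} x
  rw [Category.assoc, ← Category.assoc _ (intTgt.{w} D), ← Category.assoc, this, Category.assoc,
    intEl_idn, eone, Category.assoc]

theorem int_comp_src :
    intComp.{w} D ≫ intSrc.{w} D = intFst.{w} (V := V) D ≫ intSrc.{w} D := by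
  apply intPairs_glue (𝟙 _)
  intro Y a b c k x y e
  rw [Category.comp_id] at e
  rw [e, ← Category.assoc, ← Category.assoc, intιp_comp, intιp_fst, Category.assoc,
    Category.assoc, intι_src, intι_src]

theorem int_comp_tgt :
    intComp.{w} D ≫ intTgt.{w} D = intSnd.{w} (V := V) D ≫ intTgt.{w} D := by
  apply intPairs_glue (𝟙 _)
  intro Y a b c k x y e
  rw [Category.comp_id] at e
  rw [e, ← Category.assoc, ← Category.assoc, intιp_comp, intιp_snd, Category.assoc,
    Category.assoc, intι_tgt, intι_tgt]

variable [MonoidalClosed V]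

theorem intEl_cases {D : Type w₁} [Small.{w} D] {Z : V} {a b : D} (h : toUnit Z ≫ intEl.{w} D a = toUnit Z ≫ intEl.{w} D b) :
    a = b ∨ ∀ T : V, Nonempty (Unique (Z ⟶ T)) := by
  by_cases e : a = b
  · exact Or.inl e
  · exact Or.inr fun T => sig_ne (X := fun _ : D => 𝟙_ V) (toUnit Z) (toUnit Z) h e T

theorem intι_cases {Z : V} {a b a' b' : D} {x : Z ⟶ (a ⟶[V] b)} {x' : Z ⟶ (a' ⟶[V] b')}
    (h : x ≫ intι.{w} D a b = x' ≫ intι.{w} D a' b') :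
    (a = a' ∧ b = b') ∨ ∀ T : V, Nonempty (Unique (Z ⟶ T)) := by
  by_cases e : (a, b) = (a', b')
  · exact Or.inl (Prod.mk.inj e)
  · exact Or.inr fun T => sig_ne (X := fun p : D × D => (p.1 ⟶[V] p.2)) x x' h e T

theorem intPairs_hom_ext {Z : V} {l l' : Z ⟶ intPairs.{w} (V := V) D}
    (h₁ : l ≫ intFst.{w} D = l' ≫ intFst.{w} D) (h₂ : l ≫ intSnd.{w} D = l' ≫ intSnd.{w} D) :
    l = l' := by
  apply intPairs_glue l
  intro Y a b c k x y e
  apply intPairs_glue (k ≫ l')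
  intro Y' a' b' c' k' x' y' e'
  have e₁ : k' ≫ k ≫ l = lift (k' ≫ x) (k' ≫ y) ≫ intιp.{w} D a b c := by
    rw [e, ← Category.assoc, comp_lift]
  have h₁' : (k' ≫ x) ≫ intι.{w} D a b = x' ≫ intι.{w} D a' b' := by
    rw [← intιp_fst (k' ≫ x) (k' ≫ y), ← intιp_fst x' y', ← e₁, ← e']
    simp only [Category.assoc, h₁]
  have h₂' : (k' ≫ y) ≫ intι.{w} D b c = y' ≫ intι.{w} D b' c' := by
    rw [← intιp_snd (k' ≫ x) (k' ≫ y), ← intιp_snd x' y', ← e₁, ← e']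
    simp only [Category.assoc, h₂]
  rcases intι_cases h₁' with ⟨rfl, rfl⟩ | h
  · rcases intι_cases h₂' with ⟨_, rfl⟩ | h
    · rw [e₁, e', intι_inj h₁', intι_inj h₂']
    · exact eq_of_nonempty_unique h _ _
  · exact eq_of_nonempty_unique h _ _

theorem intPairs_exists {Z : V} (f g : Z ⟶ intMor.{w} (V := V) D)
    (h : f ≫ intTgt.{w} D = g ≫ intSrc.{w} D) :
    ∃ l : Z ⟶ intPairs.{w} (V := V) D, l ≫ intFst.{w} D = f ∧ l ≫ intSnd.{w} D = g := by
  suffices H : ∃ l : Z ⟶ intPairs.{w} (V := V) D,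
      l ≫ lift (intFst.{w} D) (intSnd.{w} D) = lift f g by
    obtain ⟨l, hl⟩ := H
    exact ⟨l, by simpa using congrArg (· ≫ fst _ _) hl, by simpa using congrArg (· ≫ snd _ _) hl⟩
  apply intMor_glue_exists f
  intro Y a b k x e
  apply intMor_glue_exists (k ≫ g)
  intro Y' b' c k' y e'
  have e₁ : k' ≫ k ≫ f = (k' ≫ x) ≫ intι.{w} D a b := by
    rw [e, ← Category.assoc]
  have h' : toUnit Y' ≫ intEl.{w} D b = toUnit Y' ≫ intEl.{w} D b' := by
    rw [← intι_tgt (k' ≫ x), ← intι_src y, ← Category.assoc, ← Category.assoc, ← e₁, ← e']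
    simp only [Category.assoc, h]
  rcases intEl_cases h' with rfl | h
  · refine ⟨lift (k' ≫ x) y ≫ intιp.{w} D a b c, ?_⟩
    rw [comp_lift, intιp_fst, intιp_snd, comp_lift, comp_lift, e₁, e']
  · obtain ⟨u⟩ := h (intPairs.{w} (V := V) D)
    exact ⟨u.default, eq_of_nonempty_unique h _ _⟩

end

theorem intPairs_isPullback [MonoidalClosed V] :
    IsPullback (intFst.{w} (V := V) D) (intSnd.{w} D) (intTgt.{w} D) (intSrc.{w} D) where
  w := by
    apply intPairs_ext
    intro a b c
    have h₁ := intιp_fst.{w} (fst (a ⟶[V] b) (b ⟶[V] c)) (snd _ _)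
    have h₂ := intιp_snd.{w} (fst (a ⟶[V] b) (b ⟶[V] c)) (snd _ _)
    rw [lift_fst_snd, Category.id_comp] at h₁ h₂
    rw [← Category.assoc, h₁, ← Category.assoc, h₂, Category.assoc, Category.assoc, intι_tgt,
      intι_src]
  isLimit' := ⟨PullbackCone.IsLimit.mk _
    (fun s => (intPairs_exists s.fst s.snd s.condition).choose)
    (fun s => (intPairs_exists s.fst s.snd s.condition).choose_spec.1)
    (fun s => (intPairs_exists s.fst s.snd s.condition).choose_spec.2)
    (fun s m h₁ h₂ => intPairs_hom_ext
      (h₁.trans (intPairs_exists s.fst s.snd s.condition).choose_spec.1.symm)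
      (h₂.trans (intPairs_exists s.fst s.snd s.condition).choose_spec.2.symm))⟩

section

variable {D} [MonoidalClosed V]

theorem intCmp_of_eq {X : V} {f g : X ⟶ intMor.{w} (V := V) D} {a b c : D}
    {x : X ⟶ (a ⟶[V] b)} {y : X ⟶ (b ⟶[V] c)} (hf : f = x ≫ intι.{w} D a b)
    (hg : g = y ≫ intι.{w} D b c) (h : f ≫ intTgt.{w} D = g ≫ intSrc.{w} D) :
    (intPairs_isPullback.{w} D).lift f g h ≫ intComp.{w} D = ecmp x y ≫ intι.{w} D a c := by
  rw [← intιp_comp]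
  congr 1
  apply intPairs_hom_ext
  · rw [IsPullback.lift_fst, intιp_fst, hf]
  · rw [IsPullback.lift_snd, intιp_snd, hg]

theorem comp_intCmp {X Y : V} (k : Y ⟶ X) {f g : X ⟶ intMor.{w} (V := V) D}
    (h : f ≫ intTgt.{w} D = g ≫ intSrc.{w} D) :
    k ≫ (intPairs_isPullback.{w} D).lift f g h ≫ intComp.{w} D =
      (intPairs_isPullback.{w} D).lift (k ≫ f) (k ≫ g)
        (by simp only [Category.assoc, h]) ≫ intComp.{w} D := by
  rw [← Category.assoc]
  congr 1
  apply intPairs_hom_ext <;> simp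

theorem comp_intCmp_of_eq {X Y : V} {k : Y ⟶ X} {f g : X ⟶ intMor.{w} (V := V) D} {a b c : D}
    {x : Y ⟶ (a ⟶[V] b)} {y : Y ⟶ (b ⟶[V] c)} (hf : k ≫ f = x ≫ intι.{w} D a b)
    (hg : k ≫ g = y ≫ intι.{w} D b c) (h : f ≫ intTgt.{w} D = g ≫ intSrc.{w} D) :
    k ≫ (intPairs_isPullback.{w} D).lift f g h ≫ intComp.{w} D =
      ecmp x y ≫ intι.{w} D a c := by
  rw [comp_intCmp, intCmp_of_eq hf hg]

/-- A composable pair is, locally, a composable pair of generalized elements of hom-objects. -/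
theorem intMor_glue_pair {Z T : V} (f g : Z ⟶ intMor.{w} (V := V) D) {p q : Z ⟶ T}
    (h : f ≫ intTgt.{w} D = g ≫ intSrc.{w} D)
    (H : ∀ (Y : V) (a b c : D) (k : Y ⟶ Z) (x : Y ⟶ (a ⟶[V] b)) (y : Y ⟶ (b ⟶[V] c)),
      k ≫ f = x ≫ intι.{w} D a b → k ≫ g = y ≫ intι.{w} D b c → k ≫ p = k ≫ q) : p = q := by
  apply intPairs_glue ((intPairs_isPullback.{w} D).lift f g h)
  intro Y a b c k x y e
  apply H Y a b c k x y
  · rw [← intιp_fst x y, ← e]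
    simp
  · rw [← intιp_snd x y, ← e]
    simp

end

/-- The internal category `Int D` of a small `V`-category `D`. -/
def Int [MonoidalClosed V] : InternalCat V where
  obj := intObj.{w} D
  mor := intMor.{w} D
  src := intSrc.{w} D
  tgt := intTgt.{w} D
  idn := intIdn.{w} D
  pairs := intPairs.{w} D
  pfst := intFst.{w} D
  psnd := intSnd.{w} D
  isPullback := intPairs_isPullback.{w} D
  comp := intComp.{w} D
  idn_src := int_idn_src
  idn_tgt := int_idn_tgt
  comp_src := int_comp_src
  comp_tgt := int_comp_tgt
  idn_comp X f h := by
    apply intMor_glue f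
    intro Y a b k x e
    rw [comp_intCmp_of_eq (x := eone Y a) (y := x) _ e, e, eone_ecmp]
    rw [← Category.assoc, e, int_src_idn]
  comp_idn X f h := by
    apply intMor_glue f
    intro Y a b k x e
    rw [comp_intCmp_of_eq (x := x) (y := eone Y b) e, e, ecmp_eone]
    rw [← Category.assoc, e, int_tgt_idn]
  assoc X f g j h₁ h₂ h₃ h₄ := by
    apply intMor_glue_pair f g h₁
    intro Y a b c k x y e₁ e₂
    apply intMor_glue_pair (k ≫ g) (k ≫ j) (by simp only [Category.assoc, h₂])
    intro Y' b' c' d k' y' z e₃ e₄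
    have e₅ : (k' ≫ k) ≫ g = (k' ≫ y) ≫ intι.{w} D b c := by simp only [Category.assoc, e₂]
    have e₆ : (k' ≫ k) ≫ f = (k' ≫ x) ≫ intι.{w} D a b := by simp only [Category.assoc, e₁]
    rw [← Category.assoc] at e₃ e₄
    rcases intι_cases (e₅.symm.trans e₃) with ⟨rfl, rfl⟩ | h
    · have l₁ := comp_intCmp_of_eq.{w} e₆ e₅ h₁
      have l₂ := comp_intCmp_of_eq.{w} e₅ e₄ h₂
      refine ((Category.assoc _ _ _).symm.trans ?_).trans (Category.assoc _ _ _)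
      rw [comp_intCmp_of_eq.{w} l₁ e₄, comp_intCmp_of_eq.{w} e₆ l₂, ecmp_assoc]
    · exact eq_of_nonempty_unique h _ _

section

variable {D} {E : Type w₂} [EnrichedCategory V E] [Small.{w} E]

/-- The map `∐_A 1 ⟶ ∐_B 1` induced by a `V`-functor. -/
def intMapObj (F : EnrichedFunctor V D E) : intObj.{w} (V := V) D ⟶ intObj.{w} (V := V) E :=
  sigDesc.{w} fun a => intEl.{w} E (F.obj a)

/-- The map `∐_{A, B} D(A, B) ⟶ ∐_{A, B} E(A, B)` induced by a `V`-functor. -/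
def intMapMor (F : EnrichedFunctor V D E) : intMor.{w} (V := V) D ⟶ intMor.{w} (V := V) E :=
  sigDesc.{w} fun p => F.map p.1 p.2 ≫ intι.{w} E (F.obj p.1) (F.obj p.2)

theorem intEl_mapObj (F : EnrichedFunctor V D E) (a : D) :
    intEl.{w} D a ≫ intMapObj.{w} F = intEl.{w} E (F.obj a) :=
  sigι_desc.{w} (fun a : D => intEl.{w} (V := V) E (F.obj a)) a

theorem intι_mapMor (F : EnrichedFunctor V D E) (a b : D) :
    intι.{w} D a b ≫ intMapMor.{w} F = F.map a b ≫ intι.{w} E (F.obj a) (F.obj b) :=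
  sigι_desc.{w} (fun p : D × D => F.map p.1 p.2 ≫ intι.{w} E (F.obj p.1) (F.obj p.2)) (a, b)

variable [MonoidalClosed V]

theorem intMapMor_cmp (F : EnrichedFunctor V D E) {X : V} (f g : X ⟶ intMor.{w} (V := V) D)
    (h : f ≫ intTgt.{w} D = g ≫ intSrc.{w} D)
    (h' : (f ≫ intMapMor.{w} F) ≫ intTgt.{w} E = (g ≫ intMapMor.{w} F) ≫ intSrc.{w} E) :
    ((intPairs_isPullback.{w} D).lift f g h ≫ intComp.{w} D) ≫ intMapMor.{w} F =
      (intPairs_isPullback.{w} E).lift (f ≫ intMapMor.{w} F) (g ≫ intMapMor.{w} F) h' ≫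
        intComp.{w} E := by
  apply intMor_glue_pair f g h
  intro Y a b c k x y e₁ e₂
  have e₃ : k ≫ f ≫ intMapMor.{w} F = (x ≫ F.map a b) ≫ intι.{w} E (F.obj a) (F.obj b) := by
    rw [← Category.assoc, e₁, Category.assoc, intι_mapMor, Category.assoc]
  have e₄ : k ≫ g ≫ intMapMor.{w} F = (y ≫ F.map b c) ≫ intι.{w} E (F.obj b) (F.obj c) := by
    rw [← Category.assoc, e₂, Category.assoc, intι_mapMor, Category.assoc]
  rw [comp_intCmp_of_eq.{w} e₃ e₄ h']
  refine (Category.assoc _ _ _).symm.trans ?_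
  rw [comp_intCmp_of_eq.{w} e₁ e₂ h, Category.assoc, intι_mapMor, ← Category.assoc, ecmp_map]

/-- The internal functor `Int F` induced by a `V`-functor `F`. -/
def Int.map (F : EnrichedFunctor V D E) :
    InternalFunctor (Int.{w} (V := V) D) (Int.{w} (V := V) E) where
  obj := intMapObj.{w} F
  mor := intMapMor.{w} F
  mor_src := by
    apply intMor_ext
    intro a b
    have h₁ := intι_src.{w} (𝟙 (a ⟶[V] b))
    rw [Category.id_comp] at h₁
    change _ ≫ _ ≫ intSrc.{w} E = _ ≫ intSrc.{w} D ≫ _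
    rw [← Category.assoc, ← Category.assoc, h₁, intι_mapMor, Category.assoc, intι_src,
      Category.assoc, intEl_mapObj]
  mor_tgt := by
    apply intMor_ext
    intro a b
    have h₁ := intι_tgt.{w} (𝟙 (a ⟶[V] b))
    rw [Category.id_comp] at h₁
    change _ ≫ _ ≫ intTgt.{w} E = _ ≫ intTgt.{w} D ≫ _
    rw [← Category.assoc, ← Category.assoc, h₁, intι_mapMor, Category.assoc, intι_tgt,
      Category.assoc, intEl_mapObj]
  idn_mor := by
    apply intObj_ext
    intro a
    change _ ≫ intIdn.{w} D ≫ _ = _ ≫ _ ≫ intIdn.{w} E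
    rw [← Category.assoc, ← Category.assoc, intEl_idn, intEl_mapObj, intEl_idn, Category.assoc,
      intι_mapMor, ← Category.assoc, F.map_id]
  cmp_mor X f g h h' := intMapMor_cmp F f g h h'

end

end Internalization

/-! ### Comma internal categories -/

section Comma

variable {V : Type u} [Category.{v} V]

namespace InternalCat

section Prod

variable [CartesianMonoidalCategory V] [HasPullbacks V]

/-- The product of two internal categories. -/
def prod (A B : InternalCat V) : InternalCat V :=
  ofElements (A.obj ⊗ B.obj) (A.mor ⊗ B.mor)
    (lift (fst _ _ ≫ A.src) (snd _ _ ≫ B.src)) (lift (fst _ _ ≫ A.tgt) (snd _ _ ≫ B.tgt))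
    (lift (fst _ _ ≫ A.idn) (snd _ _ ≫ B.idn))
    (by ext <;> simp [A.idn_src, B.idn_src])
    (by ext <;> simp [A.idn_tgt, B.idn_tgt])
    (fun X f g h => lift
      (A.cmp (f ≫ fst _ _) (g ≫ fst _ _) (by simpa using congrArg (· ≫ fst _ _) h))
      (B.cmp (f ≫ snd _ _) (g ≫ snd _ _) (by simpa using congrArg (· ≫ snd _ _) h)))
    (fun X Y k f g h h' => by
      rw [comp_lift, comp_cmp, comp_cmp]
      congr 1 <;> apply cmp_congr <;> simp)
    (fun X f g h => by ext <;> simp [cmp_src])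
    (fun X f g h => by ext <;> simp [cmp_tgt])
    (fun X f h => by
      ext
      · rw [lift_fst]
        exact idn_cmp_of_eq _ (by simp) _
      · rw [lift_snd]
        exact idn_cmp_of_eq _ (by simp) _)
    (fun X f h => by
      ext
      · rw [lift_fst]
        exact cmp_idn_of_eq _ (by simp) _
      · rw [lift_snd]
        exact cmp_idn_of_eq _ (by simp) _)
    (fun X f g k h₁ h₂ h₃ h₄ => by
      simp only [lift_fst, lift_snd]
      congr 1
      · exact cmp_assoc _ _ _ _ _ _ _ _
      · exact cmp_assoc _ _ _ _ _ _ _ _)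

theorem prod_cmp (A B : InternalCat V) {X : V} (f g : X ⟶ A.mor ⊗ B.mor)
    (h : f ≫ lift (fst _ _ ≫ A.tgt) (snd _ _ ≫ B.tgt) =
      g ≫ lift (fst _ _ ≫ A.src) (snd _ _ ≫ B.src))
    (h₁ : (f ≫ fst _ _) ≫ A.tgt = (g ≫ fst _ _) ≫ A.src)
    (h₂ : (f ≫ snd _ _) ≫ B.tgt = (g ≫ snd _ _) ≫ B.src) :
    (A.prod B).cmp f g h =
      lift (A.cmp (f ≫ fst _ _) (g ≫ fst _ _) h₁) (B.cmp (f ≫ snd _ _) (g ≫ snd _ _) h₂) :=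
  ofElements_key _ _
    (fun X f g h => lift
      (A.cmp (f ≫ fst _ _) (g ≫ fst _ _) (by simpa using congrArg (· ≫ fst _ _) h))
      (B.cmp (f ≫ snd _ _) (g ≫ snd _ _) (by simpa using congrArg (· ≫ snd _ _) h)))
    (fun X Y k f g h h' => by
      rw [comp_lift, comp_cmp, comp_cmp]
      congr 1 <;> apply cmp_congr <;> simp) _ _ h

end Prod

section Pullback

variable {A B C : InternalCat V}

theorem cmp_comp_eq (F : InternalFunctor A C) (G : InternalFunctor B C) {X : V}
    {f g : X ⟶ A.mor} {f' g' : X ⟶ B.mor} (hf : f ≫ F.mor = f' ≫ G.mor)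
    (hg : g ≫ F.mor = g' ≫ G.mor) (h : f ≫ A.tgt = g ≫ A.src) (h' : f' ≫ B.tgt = g' ≫ B.src) :
    A.cmp f g h ≫ F.mor = B.cmp f' g' h' ≫ G.mor := by
  have e : (f ≫ F.mor) ≫ C.tgt = (g ≫ F.mor) ≫ C.src := by
    rw [Category.assoc, Category.assoc, F.mor_src, F.mor_tgt, ← Category.assoc, h, Category.assoc]
  have e' : (f' ≫ G.mor) ≫ C.tgt = (g' ≫ G.mor) ≫ C.src := by rw [← hf, ← hg, e]
  rw [F.cmp_mor f g h e, G.cmp_mor f' g' h' e']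
  exact cmp_congr _ hf hg e

variable [HasPullbacks V] (F : InternalFunctor A C) (G : InternalFunctor B C)

/-- The source map of the pullback of two internal functors. -/
def pbSrc : Limits.pullback F.mor G.mor ⟶ Limits.pullback F.obj G.obj :=
  pullback.lift (pullback.fst _ _ ≫ A.src) (pullback.snd _ _ ≫ B.src) (by
    rw [Category.assoc, Category.assoc, ← F.mor_src, ← G.mor_src, pullback.condition_assoc])

theorem pbSrc_fst : pbSrc F G ≫ pullback.fst _ _ = pullback.fst _ _ ≫ A.src :=
  pullback.lift_fst _ _ _

theorem pbSrc_snd : pbSrc F G ≫ pullback.snd _ _ = pullback.snd _ _ ≫ B.src :=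
  pullback.lift_snd _ _ _

/-- The target map of the pullback of two internal functors. -/
def pbTgt : Limits.pullback F.mor G.mor ⟶ Limits.pullback F.obj G.obj :=
  pullback.lift (pullback.fst _ _ ≫ A.tgt) (pullback.snd _ _ ≫ B.tgt) (by
    rw [Category.assoc, Category.assoc, ← F.mor_tgt, ← G.mor_tgt, pullback.condition_assoc])

theorem pbTgt_fst : pbTgt F G ≫ pullback.fst _ _ = pullback.fst _ _ ≫ A.tgt :=
  pullback.lift_fst _ _ _

theorem pbTgt_snd : pbTgt F G ≫ pullback.snd _ _ = pullback.snd _ _ ≫ B.tgt :=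
  pullback.lift_snd _ _ _

/-- The identity map of the pullback of two internal functors. -/
def pbIdn : Limits.pullback F.obj G.obj ⟶ Limits.pullback F.mor G.mor :=
  pullback.lift (pullback.fst _ _ ≫ A.idn) (pullback.snd _ _ ≫ B.idn) (by
    rw [Category.assoc, Category.assoc, F.idn_mor, G.idn_mor, pullback.condition_assoc])

theorem pbIdn_fst : pbIdn F G ≫ pullback.fst _ _ = pullback.fst _ _ ≫ A.idn :=
  pullback.lift_fst _ _ _

theorem pbIdn_snd : pbIdn F G ≫ pullback.snd _ _ = pullback.snd _ _ ≫ B.idn :=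
  pullback.lift_snd _ _ _

section

variable {F G} {X : V} {f g : X ⟶ Limits.pullback F.mor G.mor}

theorem pb_fst (h : f ≫ pbTgt F G = g ≫ pbSrc F G) :
    (f ≫ pullback.fst _ _) ≫ A.tgt = (g ≫ pullback.fst _ _) ≫ A.src := by
  rw [Category.assoc, Category.assoc, ← pbTgt_fst, ← pbSrc_fst, ← Category.assoc, h,
    Category.assoc]

theorem pb_snd (h : f ≫ pbTgt F G = g ≫ pbSrc F G) :
    (f ≫ pullback.snd _ _) ≫ B.tgt = (g ≫ pullback.snd _ _) ≫ B.src := by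
  rw [Category.assoc, Category.assoc, ← pbTgt_snd, ← pbSrc_snd, ← Category.assoc, h,
    Category.assoc]

end

/-- The composition of the pullback of two internal functors, on generalized elements. -/
def pbCmp {X : V} (f g : X ⟶ Limits.pullback F.mor G.mor) (h : f ≫ pbTgt F G = g ≫ pbSrc F G) :
    X ⟶ Limits.pullback F.mor G.mor :=
  pullback.lift
    (A.cmp (f ≫ pullback.fst _ _) (g ≫ pullback.fst _ _) (pb_fst h))
    (B.cmp (f ≫ pullback.snd _ _) (g ≫ pullback.snd _ _) (pb_snd h))
    (cmp_comp_eq F G (by rw [Category.assoc, pullback.condition, Category.assoc])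
      (by rw [Category.assoc, pullback.condition, Category.assoc]) _ _)

theorem pbCmp_fst {X : V} (f g : X ⟶ Limits.pullback F.mor G.mor)
    (h : f ≫ pbTgt F G = g ≫ pbSrc F G) :
    pbCmp F G f g h ≫ pullback.fst _ _ =
      A.cmp (f ≫ pullback.fst _ _) (g ≫ pullback.fst _ _) (pb_fst h) :=
  pullback.lift_fst _ _ _

theorem pbCmp_snd {X : V} (f g : X ⟶ Limits.pullback F.mor G.mor)
    (h : f ≫ pbTgt F G = g ≫ pbSrc F G) :
    pbCmp F G f g h ≫ pullback.snd _ _ =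
      B.cmp (f ≫ pullback.snd _ _) (g ≫ pullback.snd _ _) (pb_snd h) :=
  pullback.lift_snd _ _ _

/-- The pullback of two internal functors, formed on objects and on morphisms. -/
def pullback : InternalCat V :=
  ofElements (Limits.pullback F.obj G.obj) (Limits.pullback F.mor G.mor)
    (pbSrc F G) (pbTgt F G) (pbIdn F G)
    (by
      apply pullback.hom_ext
      · rw [Category.assoc, pbSrc_fst, ← Category.assoc, pbIdn_fst, Category.assoc, A.idn_src,
          Category.comp_id, Category.id_comp]
      · rw [Category.assoc, pbSrc_snd, ← Category.assoc, pbIdn_snd, Category.assoc, B.idn_src,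
          Category.comp_id, Category.id_comp])
    (by
      apply pullback.hom_ext
      · rw [Category.assoc, pbTgt_fst, ← Category.assoc, pbIdn_fst, Category.assoc, A.idn_tgt,
          Category.comp_id, Category.id_comp]
      · rw [Category.assoc, pbTgt_snd, ← Category.assoc, pbIdn_snd, Category.assoc, B.idn_tgt,
          Category.comp_id, Category.id_comp])
    (fun X f g h => pbCmp F G f g h)
    (fun X Y k f g h h' => by
      apply pullback.hom_ext
      · simp only [Category.assoc, pbCmp_fst, comp_cmp]
      · simp only [Category.assoc, pbCmp_snd, comp_cmp])
    (fun X f g h => by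
      apply pullback.hom_ext
      · rw [Category.assoc, Category.assoc, pbSrc_fst, ← Category.assoc, pbCmp_fst, cmp_src,
          Category.assoc]
      · rw [Category.assoc, Category.assoc, pbSrc_snd, ← Category.assoc, pbCmp_snd, cmp_src,
          Category.assoc])
    (fun X f g h => by
      apply pullback.hom_ext
      · rw [Category.assoc, Category.assoc, pbTgt_fst, ← Category.assoc, pbCmp_fst, cmp_tgt,
          Category.assoc]
      · rw [Category.assoc, Category.assoc, pbTgt_snd, ← Category.assoc, pbCmp_snd, cmp_tgt,
          Category.assoc])
    (fun X f h => by
      apply pullback.hom_ext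
      · rw [pbCmp_fst]
        refine idn_cmp_of_eq _ ?_ _
        rw [Category.assoc, Category.assoc, pbIdn_fst, ← Category.assoc (pbSrc F G), pbSrc_fst]
        simp only [Category.assoc]
      · rw [pbCmp_snd]
        refine idn_cmp_of_eq _ ?_ _
        rw [Category.assoc, Category.assoc, pbIdn_snd, ← Category.assoc (pbSrc F G), pbSrc_snd]
        simp only [Category.assoc])
    (fun X f h => by
      apply pullback.hom_ext
      · rw [pbCmp_fst]
        refine cmp_idn_of_eq _ ?_ _
        rw [Category.assoc, Category.assoc, pbIdn_fst, ← Category.assoc (pbTgt F G), pbTgt_fst]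
        simp only [Category.assoc]
      · rw [pbCmp_snd]
        refine cmp_idn_of_eq _ ?_ _
        rw [Category.assoc, Category.assoc, pbIdn_snd, ← Category.assoc (pbTgt F G), pbTgt_snd]
        simp only [Category.assoc])
    (fun X f g k h₁ h₂ h₃ h₄ => by
      apply pullback.hom_ext
      · simp only [pbCmp_fst]
        exact cmp_assoc _ _ _ _ _ _ _ _
      · simp only [pbCmp_snd]
        exact cmp_assoc _ _ _ _ _ _ _ _)

end Pullback

section Arrow

variable {B : InternalCat V} {X Y : V}

theorem sq_paste {f b b' t t' g k : X ⟶ B.mor} (h₁ : f ≫ B.tgt = b ≫ B.src)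
    (h₂ : t ≫ B.tgt = g ≫ B.src) (h : B.cmp f b h₁ = B.cmp t g h₂)
    (h₁' : g ≫ B.tgt = b' ≫ B.src) (h₂' : t' ≫ B.tgt = k ≫ B.src)
    (h' : B.cmp g b' h₁' = B.cmp t' k h₂') (hb : b ≫ B.tgt = b' ≫ B.src)
    (ht : t ≫ B.tgt = t' ≫ B.src) (e₁ : f ≫ B.tgt = B.cmp b b' hb ≫ B.src)
    (e₂ : B.cmp t t' ht ≫ B.tgt = k ≫ B.src) :
    B.cmp f (B.cmp b b' hb) e₁ = B.cmp (B.cmp t t' ht) k e₂ := by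
  have e₃ : B.cmp f b h₁ ≫ B.tgt = b' ≫ B.src := by rw [cmp_tgt, hb]
  have e₄ : t ≫ B.tgt = B.cmp g b' h₁' ≫ B.src := by rw [cmp_src, h₂]
  have e₅ : t ≫ B.tgt = B.cmp t' k h₂' ≫ B.src := by rw [cmp_src, ht]
  rw [← cmp_assoc _ f b b' h₁ hb e₃ e₁, cmp_assoc _ t t' k ht h₂' e₂ e₅,
    cmp_congr _ h rfl e₃, cmp_assoc _ t g b' h₂ h₁' _ e₄]
  exact cmp_congr _ rfl h' _

theorem lift_comp_eq {f b t g : X ⟶ B.mor} {h₁ : f ≫ B.tgt = b ≫ B.src}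
    {h₂ : t ≫ B.tgt = g ≫ B.src} (h : B.cmp f b h₁ = B.cmp t g h₂) :
    B.isPullback.lift f b h₁ ≫ B.comp = B.isPullback.lift t g h₂ ≫ B.comp :=
  h

variable [HasPullbacks V]

variable (B)

/-- The object of commutative squares in `B`, i.e. of two composable pairs `(f, b)` and `(t, g)`
with the same composite. We think of `f` and `g` as the left and right sides, and of `t` and `b`
as the top and bottom sides. -/
abbrev sq : V := Limits.pullback B.comp B.comp

/-- The left side of a square. -/
def sqLeft : B.sq ⟶ B.mor := pullback.fst _ _ ≫ B.pfst

/-- The bottom side of a square. -/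
def sqBot : B.sq ⟶ B.mor := pullback.fst _ _ ≫ B.psnd

/-- The top side of a square. -/
def sqTop : B.sq ⟶ B.mor := pullback.snd _ _ ≫ B.pfst

/-- The right side of a square. -/
def sqRight : B.sq ⟶ B.mor := pullback.snd _ _ ≫ B.psnd

variable {B}

/-- The generalized element of `B.sq` with given sides. -/
def sqMk (f b t g : X ⟶ B.mor) (h₁ : f ≫ B.tgt = b ≫ B.src) (h₂ : t ≫ B.tgt = g ≫ B.src)
    (h : B.cmp f b h₁ = B.cmp t g h₂) : X ⟶ B.sq :=
  pullback.lift (B.isPullback.lift f b h₁) (B.isPullback.lift t g h₂) (lift_comp_eq h)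

section

variable (f b t g : X ⟶ B.mor) (h₁ : f ≫ B.tgt = b ≫ B.src) (h₂ : t ≫ B.tgt = g ≫ B.src)
  (h : B.cmp f b h₁ = B.cmp t g h₂)

theorem sqMk_left : sqMk f b t g h₁ h₂ h ≫ B.sqLeft = f := by
  rw [sqMk, sqLeft, pullback.lift_fst_assoc, IsPullback.lift_fst]

theorem sqMk_bot : sqMk f b t g h₁ h₂ h ≫ B.sqBot = b := by
  rw [sqMk, sqBot, pullback.lift_fst_assoc, IsPullback.lift_snd]

theorem sqMk_top : sqMk f b t g h₁ h₂ h ≫ B.sqTop = t := by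
  rw [sqMk, sqTop, pullback.lift_snd_assoc, IsPullback.lift_fst]

theorem sqMk_right : sqMk f b t g h₁ h₂ h ≫ B.sqRight = g := by
  rw [sqMk, sqRight, pullback.lift_snd_assoc, IsPullback.lift_snd]

end

theorem sq_ext {s s' : X ⟶ B.sq} (h₁ : s ≫ B.sqLeft = s' ≫ B.sqLeft)
    (h₂ : s ≫ B.sqBot = s' ≫ B.sqBot) (h₃ : s ≫ B.sqTop = s' ≫ B.sqTop)
    (h₄ : s ≫ B.sqRight = s' ≫ B.sqRight) : s = s' := by
  apply pullback.hom_ext <;> apply B.isPullback.hom_ext <;>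
    simpa only [Category.assoc, sqLeft, sqBot, sqTop, sqRight] using by assumption

theorem sq_left_bot (s : X ⟶ B.sq) : (s ≫ B.sqLeft) ≫ B.tgt = (s ≫ B.sqBot) ≫ B.src := by
  simp only [sqLeft, sqBot, Category.assoc, B.isPullback.w]

theorem sq_top_right (s : X ⟶ B.sq) : (s ≫ B.sqTop) ≫ B.tgt = (s ≫ B.sqRight) ≫ B.src := by
  simp only [sqTop, sqRight, Category.assoc, B.isPullback.w]

theorem sq_comm (s : X ⟶ B.sq) :
    B.cmp (s ≫ B.sqLeft) (s ≫ B.sqBot) (sq_left_bot s) =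
      B.cmp (s ≫ B.sqTop) (s ≫ B.sqRight) (sq_top_right s) := by
  have h₁ : B.isPullback.lift _ _ (sq_left_bot s) = s ≫ pullback.fst _ _ := by
    apply B.isPullback.hom_ext <;> simp [sqLeft, sqBot]
  have h₂ : B.isPullback.lift _ _ (sq_top_right s) = s ≫ pullback.snd _ _ := by
    apply B.isPullback.hom_ext <;> simp [sqTop, sqRight]
  rw [cmp, cmp, h₁, h₂, Category.assoc, Category.assoc, pullback.condition]

theorem sq_src (s : X ⟶ B.sq) : (s ≫ B.sqLeft) ≫ B.src = (s ≫ B.sqTop) ≫ B.src := by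
  rw [← cmp_src _ _ _ (sq_left_bot s), sq_comm, cmp_src]

theorem sq_tgt (s : X ⟶ B.sq) : (s ≫ B.sqBot) ≫ B.tgt = (s ≫ B.sqRight) ≫ B.tgt := by
  rw [← cmp_tgt _ _ _ (sq_left_bot s), sq_comm, cmp_tgt]

theorem sq_top_top {s s' : X ⟶ B.sq} (h : s ≫ B.sqRight = s' ≫ B.sqLeft) :
    (s ≫ B.sqTop) ≫ B.tgt = (s' ≫ B.sqTop) ≫ B.src := by
  rw [sq_top_right, h, sq_src]

theorem sq_bot_bot {s s' : X ⟶ B.sq} (h : s ≫ B.sqRight = s' ≫ B.sqLeft) :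
    (s ≫ B.sqBot) ≫ B.tgt = (s' ≫ B.sqBot) ≫ B.src := by
  rw [sq_tgt, h, sq_left_bot]

/-- Pasting of squares along a common side. -/
def sqPaste (s s' : X ⟶ B.sq) (h : s ≫ B.sqRight = s' ≫ B.sqLeft) : X ⟶ B.sq :=
  sqMk (s ≫ B.sqLeft) (B.cmp (s ≫ B.sqBot) (s' ≫ B.sqBot) (sq_bot_bot h))
    (B.cmp (s ≫ B.sqTop) (s' ≫ B.sqTop) (sq_top_top h)) (s' ≫ B.sqRight)
    (by rw [cmp_src, sq_left_bot])
    (by rw [cmp_tgt, sq_top_right])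
    (sq_paste (sq_left_bot s) (sq_top_right s) (sq_comm s) (by rw [h, sq_left_bot])
      (sq_top_right s') ((cmp_congr _ h rfl _).trans (sq_comm s')) _ _ _ _)

variable (B)

/-- The identity square on an arrow. -/
def sqIdn : B.mor ⟶ B.sq :=
  sqMk (𝟙 _) (B.tgt ≫ B.idn) (B.src ≫ B.idn) (𝟙 _)
    (by rw [Category.id_comp, Category.assoc, B.idn_src, Category.comp_id])
    (by rw [Category.id_comp, Category.assoc, B.idn_tgt, Category.comp_id])
    (by
      rw [cmp_idn_of_eq, idn_cmp_of_eq]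
      · simp
      · simp)

theorem sqIdn_left : B.sqIdn ≫ B.sqLeft = 𝟙 _ := sqMk_left _ _ _ _ _ _ _

theorem sqIdn_bot : B.sqIdn ≫ B.sqBot = B.tgt ≫ B.idn := sqMk_bot _ _ _ _ _ _ _

theorem sqIdn_top : B.sqIdn ≫ B.sqTop = B.src ≫ B.idn := sqMk_top _ _ _ _ _ _ _

theorem sqIdn_right : B.sqIdn ≫ B.sqRight = 𝟙 _ := sqMk_right _ _ _ _ _ _ _

/-- The internal category `⟦2, B⟧` of arrows in `B`: its objects are the morphisms of `B` and its
morphisms from `f` to `g` are the commutative squares with left side `f` and right side `g`. -/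
def arrow : InternalCat V :=
  ofElements B.mor B.sq B.sqLeft B.sqRight B.sqIdn
    B.sqIdn_left B.sqIdn_right
    (fun X s s' h => sqPaste s s' h)
    (fun X Y k s s' h h' => by
      apply sq_ext <;> simp only [sqPaste, Category.assoc, sqMk_left, sqMk_bot, sqMk_top,
        sqMk_right, comp_cmp])
    (fun X s s' h => sqMk_left _ _ _ _ _ _ _)
    (fun X s s' h => sqMk_right _ _ _ _ _ _ _)
    (fun X s h => by
      apply sq_ext
      · simp only [sqPaste, sqMk_left, Category.assoc, sqIdn_left, Category.comp_id]
      · rw [sqPaste, sqMk_bot]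
        refine idn_cmp_of_eq _ ?_ _
        rw [← Category.assoc (s ≫ B.sqBot), ← sq_left_bot]
        simp only [Category.assoc, sqIdn_bot]
      · rw [sqPaste, sqMk_top]
        refine idn_cmp_of_eq _ ?_ _
        rw [← Category.assoc (s ≫ B.sqTop), ← sq_src]
        simp only [Category.assoc, sqIdn_top]
      · simp only [sqPaste, sqMk_right])
    (fun X s h => by
      apply sq_ext
      · simp only [sqPaste, sqMk_left]
      · rw [sqPaste, sqMk_bot]
        refine cmp_idn_of_eq _ ?_ _
        rw [← Category.assoc (s ≫ B.sqBot), sq_tgt]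
        simp only [Category.assoc, sqIdn_bot]
      · rw [sqPaste, sqMk_top]
        refine cmp_idn_of_eq _ ?_ _
        rw [← Category.assoc (s ≫ B.sqTop), sq_top_right]
        simp only [Category.assoc, sqIdn_top]
      · simp only [sqPaste, sqMk_right, Category.assoc, sqIdn_right, Category.comp_id])
    (fun X s s' s'' h₁ h₂ h₃ h₄ => by
      apply sq_ext
      · simp only [sqPaste, sqMk_left]
      · simp only [sqPaste, sqMk_bot]
        exact cmp_assoc _ _ _ _ _ _ _ _
      · simp only [sqPaste, sqMk_top]
        exact cmp_assoc _ _ _ _ _ _ _ _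
      · simp only [sqPaste, sqMk_right])

theorem arrow_cmp (s s' : X ⟶ B.sq) (h : s ≫ B.sqRight = s' ≫ B.sqLeft) :
    B.arrow.cmp s s' h = sqPaste s s' h :=
  ofElements_key _ _ (fun X s s' h => sqPaste s s' h) (fun X Y k s s' h h' => by
    apply sq_ext <;> simp only [sqPaste, Category.assoc, sqMk_left, sqMk_bot, sqMk_top,
      sqMk_right, comp_cmp]) _ _ h

/-- The internal functor `⟦2, B⟧ ⟶ B` which takes the source of an arrow. -/
def arrowSrc : InternalFunctor B.arrow B where
  obj := B.src
  mor := B.sqTop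
  mor_src := by
    have h := sq_src (𝟙 B.sq)
    rw [Category.id_comp, Category.id_comp] at h
    exact h.symm
  mor_tgt := by
    have h := sq_top_right (𝟙 B.sq)
    rwa [Category.id_comp, Category.id_comp] at h
  idn_mor := B.sqIdn_top
  cmp_mor X s s' h h' := (congrArg (· ≫ B.sqTop) (arrow_cmp B s s' h)).trans
    (sqMk_top _ _ _ _ _ _ _)

/-- The internal functor `⟦2, B⟧ ⟶ B` which takes the target of an arrow. -/
def arrowTgt : InternalFunctor B.arrow B where
  obj := B.tgt
  mor := B.sqBot
  mor_src := by
    have h := sq_left_bot (𝟙 B.sq)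
    rw [Category.id_comp, Category.id_comp] at h
    exact h.symm
  mor_tgt := by
    have h := sq_tgt (𝟙 B.sq)
    rwa [Category.id_comp, Category.id_comp] at h
  idn_mor := B.sqIdn_bot
  cmp_mor X s s' h h' := (congrArg (· ≫ B.sqBot) (arrow_cmp B s s' h)).trans
    (sqMk_bot _ _ _ _ _ _ _)

end Arrow

end InternalCat

section CommaCat

variable [CartesianMonoidalCategory V] [HasPullbacks V]

open InternalCat

/-- The internal functor `A ⟶ B × C` with components `F` and `G`. -/
def InternalFunctor.pair {A B C : InternalCat V} (F : InternalFunctor A B)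
    (G : InternalFunctor A C) : InternalFunctor A (B.prod C) where
  obj := lift F.obj G.obj
  mor := lift F.mor G.mor
  mor_src := by
    change lift F.mor G.mor ≫ lift (fst _ _ ≫ B.src) (snd _ _ ≫ C.src) =
      (A.src ≫ lift F.obj G.obj : A.mor ⟶ B.obj ⊗ C.obj)
    rw [comp_lift, comp_lift, lift_fst_assoc, lift_snd_assoc, F.mor_src, G.mor_src]
  mor_tgt := by
    change lift F.mor G.mor ≫ lift (fst _ _ ≫ B.tgt) (snd _ _ ≫ C.tgt) =
      (A.tgt ≫ lift F.obj G.obj : A.mor ⟶ B.obj ⊗ C.obj)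
    rw [comp_lift, comp_lift, lift_fst_assoc, lift_snd_assoc, F.mor_tgt, G.mor_tgt]
  idn_mor := by
    change (A.idn ≫ lift F.mor G.mor : A.obj ⟶ B.mor ⊗ C.mor) =
      lift F.obj G.obj ≫ lift (fst _ _ ≫ B.idn) (snd _ _ ≫ C.idn)
    rw [comp_lift, comp_lift, lift_fst_assoc, lift_snd_assoc, F.idn_mor, G.idn_mor]
  cmp_mor X f g h h' := by
    have e : ∀ {P : InternalCat V} (K : InternalFunctor A P),
        (f ≫ K.mor) ≫ P.tgt = (g ≫ K.mor) ≫ P.src := fun K => by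
      rw [Category.assoc, Category.assoc, K.mor_src, K.mor_tgt, ← Category.assoc, h,
        Category.assoc]
    have e₁ : ∀ k : X ⟶ A.mor, (k ≫ lift F.mor G.mor) ≫ fst _ _ = k ≫ F.mor := fun k => by
      rw [Category.assoc, lift_fst]
    have e₂ : ∀ k : X ⟶ A.mor, (k ≫ lift F.mor G.mor) ≫ snd _ _ = k ≫ G.mor := fun k => by
      rw [Category.assoc, lift_snd]
    refine Eq.trans ?_ (prod_cmp B C (f ≫ lift F.mor G.mor) (g ≫ lift F.mor G.mor) h'
      (by rw [e₁, e₁, e]) (by rw [e₂, e₂, e])).symm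
    change (_ ≫ lift F.mor G.mor : X ⟶ B.mor ⊗ C.mor) = _
    rw [comp_lift, F.cmp_mor f g h (e F), G.cmp_mor f g h (e G)]
    congr 1
    · exact cmp_congr _ (e₁ f).symm (e₁ g).symm _
    · exact cmp_congr _ (e₂ f).symm (e₂ g).symm _

/-- The constant internal functor `A ⟶ 1 ⟶ B` at an element `b` of `B`. -/
def InternalFunctor.const (A : InternalCat V) {B : InternalCat V} (b : 𝟙_ V ⟶ B.obj) :
    InternalFunctor A B where
  obj := toUnit _ ≫ b
  mor := toUnit _ ≫ b ≫ B.idn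
  mor_src := by
    rw [Category.assoc, Category.assoc, B.idn_src, Category.comp_id, ← Category.assoc, comp_toUnit]
  mor_tgt := by
    rw [Category.assoc, Category.assoc, B.idn_tgt, Category.comp_id, ← Category.assoc, comp_toUnit]
  idn_mor := by
    rw [← Category.assoc, comp_toUnit, Category.assoc]
  cmp_mor X f g h h' := by
    have e : ∀ k : X ⟶ A.mor, k ≫ toUnit _ ≫ b ≫ B.idn = toUnit X ≫ b ≫ B.idn := fun k => by
      rw [← Category.assoc, comp_toUnit]
    rw [e]
    refine Eq.trans (e g).symm (idn_cmp_of_eq _ ?_ _).symm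
    rw [e, e]
    simp only [Category.assoc]
    rw [← Category.assoc B.idn, B.idn_src, Category.id_comp]

/-- The comma internal category `H ↓ b` of an internal functor `H : A ⟶ B` and an element `b` of
`B`: the pullback of `(H, b) : A ⟶ B × B` along `(source, target) : ⟦2, B⟧ ⟶ B × B`. -/
def comma {A B : InternalCat V} (H : InternalFunctor A B) (b : 𝟙_ V ⟶ B.obj) : InternalCat V :=
  InternalCat.pullback (H.pair (InternalFunctor.const A b)) (B.arrowSrc.pair B.arrowTgt)

/-- The element of `H ↓ b` given by an element `a` of `A` and an element of the object of
morphisms of `B` with source `H a` and target `b`. -/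
def commaElement {A B : InternalCat V} (H : InternalFunctor A B) (b : 𝟙_ V ⟶ B.obj)
    (a : 𝟙_ V ⟶ A.obj) (x : 𝟙_ V ⟶ B.mor) (hs : x ≫ B.src = a ≫ H.obj) (ht : x ≫ B.tgt = b) :
    𝟙_ V ⟶ (comma H b).obj :=
  pullback.lift (f := (H.pair (InternalFunctor.const A b)).obj)
    (g := (B.arrowSrc.pair B.arrowTgt).obj) a x (by
    change a ≫ lift H.obj (toUnit _ ≫ b) = x ≫ lift B.src B.tgt
    rw [comp_lift, comp_lift, hs, ht, ← Category.assoc, toUnit_unique (a ≫ toUnit _) (𝟙 _),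
      Category.id_comp])

end CommaCat

/-! ### The underlying `V`-category of an internal category -/

section Und

variable [CartesianMonoidalCategory V] [HasPullbacks V]

/-- The objects of the underlying `V`-category of `A` are the elements `1 ⟶ A` of its object of
objects. -/
def Und (A : InternalCat V) : Type v := 𝟙_ V ⟶ A.obj

variable (A : InternalCat V)

/-- The hom-object of `Und A` from `a` to `b`, the pullback of `(src, tgt)` along `(a, b)`. -/
abbrev undHom (a b : 𝟙_ V ⟶ A.obj) : V := pullback (lift A.src A.tgt) (lift a b)

/-- The projection from the hom-object of `Und A` to the object of morphisms of `A`. -/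
def undπ (a b : 𝟙_ V ⟶ A.obj) : undHom A a b ⟶ A.mor := pullback.fst _ _

variable {A} {a b c : 𝟙_ V ⟶ A.obj} {X : V}

theorem undπ_src (f : X ⟶ undHom A a b) : (f ≫ undπ A a b) ≫ A.src = toUnit X ≫ a := by
  have h : undπ A a b ≫ lift A.src A.tgt = pullback.snd _ _ ≫ lift a b := pullback.condition
  have h' := congrArg (fun t => f ≫ t ≫ fst _ _) h
  simp only [Category.assoc, lift_fst] at h'
  rw [Category.assoc, h', ← Category.assoc]
  congr 1
  exact toUnit_unique _ _

theorem undπ_tgt (f : X ⟶ undHom A a b) : (f ≫ undπ A a b) ≫ A.tgt = toUnit X ≫ b := by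
  have h : undπ A a b ≫ lift A.src A.tgt = pullback.snd _ _ ≫ lift a b := pullback.condition
  have h' := congrArg (fun t => f ≫ t ≫ snd _ _) h
  simp only [Category.assoc, lift_snd] at h'
  rw [Category.assoc, h', ← Category.assoc]
  congr 1
  exact toUnit_unique _ _

theorem und_ext {f g : X ⟶ undHom A a b} (h : f ≫ undπ A a b = g ≫ undπ A a b) : f = g :=
  pullback.hom_ext h (by
    rw [← cancel_mono (𝟙 (𝟙_ V))]
    exact toUnit_unique _ _)

/-- The generalized element of a hom-object of `Und A` given by a generalized element of the
object of morphisms of `A` with the right source and target. -/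
def undLift (f : X ⟶ A.mor) (hs : f ≫ A.src = toUnit X ≫ a) (ht : f ≫ A.tgt = toUnit X ≫ b) :
    X ⟶ undHom A a b :=
  pullback.lift f (toUnit X) (by rw [comp_lift, comp_lift, hs, ht])

theorem undLift_π (f : X ⟶ A.mor) (hs : f ≫ A.src = toUnit X ≫ a)
    (ht : f ≫ A.tgt = toUnit X ≫ b) : undLift f hs ht ≫ undπ A a b = f :=
  pullback.lift_fst _ _ _

variable (A a b c)

/-- The identity of `Und A` at `a`. -/
def undId : 𝟙_ V ⟶ undHom A a a :=
  undLift (a ≫ A.idn)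
    (by rw [Category.assoc, A.idn_src, Category.comp_id, toUnit_unique (toUnit (𝟙_ V)) (𝟙 _),
      Category.id_comp])
    (by rw [Category.assoc, A.idn_tgt, Category.comp_id, toUnit_unique (toUnit (𝟙_ V)) (𝟙 _),
      Category.id_comp])

/-- The composition of `Und A`, induced by the composition of `A`. -/
def undComp : undHom A a b ⊗ undHom A b c ⟶ undHom A a c :=
  undLift (A.cmp (fst _ _ ≫ undπ A a b) (snd _ _ ≫ undπ A b c) (by rw [undπ_src, undπ_tgt]))
    (by rw [InternalCat.cmp_src, undπ_src])
    (by rw [InternalCat.cmp_tgt, undπ_tgt])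

variable {A a b c}

theorem undId_π : (toUnit X ≫ undId A a) ≫ undπ A a a = toUnit X ≫ a ≫ A.idn := by
  rw [Category.assoc, undId, undLift_π]

theorem undComp_π (f : X ⟶ undHom A a b) (g : X ⟶ undHom A b c) :
    (lift f g ≫ undComp A a b c) ≫ undπ A a c =
      A.cmp (f ≫ undπ A a b) (g ≫ undπ A b c) (by rw [undπ_src, undπ_tgt]) := by
  rw [Category.assoc, undComp, undLift_π, InternalCat.comp_cmp]
  apply InternalCat.cmp_congr
  · rw [lift_fst_assoc]
  · rw [lift_snd_assoc]

theorem und_id_comp (f : X ⟶ undHom A a b) :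
    lift (toUnit X ≫ undId A a) f ≫ undComp A a a b = f :=
  und_ext (by
    rw [undComp_π]
    refine InternalCat.idn_cmp_of_eq _ ?_ _
    rw [undId_π, ← Category.assoc (f ≫ undπ A a b), undπ_src, Category.assoc])

theorem und_comp_id (f : X ⟶ undHom A a b) :
    lift f (toUnit X ≫ undId A b) ≫ undComp A a b b = f :=
  und_ext (by
    rw [undComp_π]
    refine InternalCat.cmp_idn_of_eq _ ?_ _
    rw [undId_π, ← Category.assoc (f ≫ undπ A a b), undπ_tgt, Category.assoc])

theorem und_assoc {d : 𝟙_ V ⟶ A.obj} (f : X ⟶ undHom A a b) (g : X ⟶ undHom A b c)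
    (h : X ⟶ undHom A c d) :
    lift (lift f g ≫ undComp A a b c) h ≫ undComp A a c d =
      lift f (lift g h ≫ undComp A b c d) ≫ undComp A a b d :=
  und_ext (by
    simp only [undComp_π]
    exact InternalCat.cmp_assoc _ _ _ _ _ _ _ _)

/-- The underlying `V`-category of an internal category. -/
instance undEnriched (A : InternalCat V) : EnrichedCategory V (Und A) :=
  mkCategory (Und A) (undHom A) (undId A) (undComp A)
    (fun _ _ _ f => und_id_comp f) (fun _ _ _ f => und_comp_id f)
    (fun _ _ _ _ _ f g h => und_assoc f g h)

end Und

end Comma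


/-! ### The internal category of weighted cones -/

section Cones

variable {V : Type u} [Category.{v} V] [CartesianMonoidalCategory V]

/-- The full sub-`V`-category of `D` on a set of objects. -/
instance fullSub {D : Type w₁} [EnrichedCategory V D] (S : Set D) : EnrichedCategory V S where
  Hom a b := (a.1 ⟶[V] b.1)
  id a := eId V a.1
  comp a b c := eComp V a.1 b.1 c.1
  id_comp a b := e_id_comp V a.1 b.1
  comp_id a b := e_comp_id V a.1 b.1
  assoc a b c d := EnrichedCategory.assoc (V := V) a.1 b.1 c.1 d.1

/-- A `V`-functor whose values on objects lie in `S`, as a `V`-functor to the full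
sub-`V`-category on `S`. -/
def corestrict {C : Type w₁} [EnrichedCategory V C] {D : Type w₂} [EnrichedCategory V D]
    (F : EnrichedFunctor V C D) (S : Set D) (h : ∀ c, F.obj c ∈ S) : EnrichedFunctor V C S where
  obj c := ⟨F.obj c, h c⟩
  map a b := F.map a b
  map_id a := F.map_id a
  map_comp a b c := F.map_comp a b c

/-- The opposite `C ⥤ Dᵒᵖ` of a `V`-functor `Cᵒᵖ ⥤ D`. -/
def opFunctor [BraidedCategory V] {C : Type w₁} [EnrichedCategory V C] {D : Type w₂}
    [EnrichedCategory V D] (F : EnrichedFunctor V Cᵒᵖ D) : EnrichedFunctor V C Dᵒᵖ :=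
  mkFunctor (fun c => op (F.obj (op c))) (fun a b => F.map (op b) (op a))
    (fun a _ => eone_map F (a := op a))
    (fun a b c X f g => by
      have h := ecmp_map F (X := X) (a := op c) (b := op b) (c := op a) g f
      rw [ecmp_op] at h
      refine h.trans ?_
      rw [ecmp_op])

variable [MonoidalClosed V] [BraidedCategory V] [HasPullbacks V] [Extensive.{w} V]
  {C : Type w₁} [EnrichedCategory V C] [Small.{w} C] {I : Type w₂} [EnrichedCategory V I]
  [HasProductsOfShape I V]

/-- For a small set `S` of objects of `V^I` containing all `C(a, G -)`, the internal functor
`Int C(-, G)ᵒᵖ : Int C ⟶ Int (V^I)ᵒᵖ`, where `V^I` is restricted to the objects in `S`. -/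
def coneInternalFunctor (G : EnrichedFunctor V I C) (S : Set (EnrichedFunctor V I V))
    [Small.{w} S] (hG : ∀ a : C, homInto G a ∈ S) :
    InternalFunctor (Int.{w} (V := V) C) (Int.{w} (V := V) (S : Type _)ᵒᵖ) :=
  Int.map.{w} (opFunctor (corestrict (homIntoFunctor G) S fun a => hG a.unop))

/-- The internal category `W ↓ Int C(-, G)` of weighted cones, the comma internal category of
`Int C(-, G)ᵒᵖ : Int C ⟶ Int (V^I)ᵒᵖ` over the element `W`. -/
def weightedCones (G : EnrichedFunctor V I C) (W : EnrichedFunctor V I V)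
    (S : Set (EnrichedFunctor V I V)) [Small.{w} S] (hW : W ∈ S)
    (hG : ∀ a : C, homInto G a ∈ S) : InternalCat V :=
  comma (coneInternalFunctor.{w} G S hG) (intEl.{w} (S : Type _)ᵒᵖ (op ⟨W, hW⟩))

/-- The object of `Und (W ↓ Int C(-, G))` given by the pair `(L, lam)`. -/
def coneElement (G : EnrichedFunctor V I C) (W : EnrichedFunctor V I V)
    (S : Set (EnrichedFunctor V I V)) [Small.{w} S] (hW : W ∈ S)
    (hG : ∀ a : C, homInto G a ∈ S) (L : C) (lam : VNatTrans W (homInto G L)) :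
    Und (weightedCones.{w} G W S hW hG) :=
  commaElement (coneInternalFunctor.{w} G S hG) (intEl.{w} (S : Type _)ᵒᵖ (op ⟨W, hW⟩))
    (intEl.{w} C L)
    (lam.toElement ≫ intι.{w} (S : Type _)ᵒᵖ (op ⟨homInto G L, hG L⟩) (op ⟨W, hW⟩))
    (by
      refine (Category.assoc _ _ _).trans ((intι_src.{w} (D := (S : Type _)ᵒᵖ) (V := V)
        (a := op ⟨homInto G L, hG L⟩) (b := op ⟨W, hW⟩) lam.toElement).trans ?_)
      refine Eq.trans ?_ (intEl_mapObj.{w} _ L).symm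
      rw [toUnit_unique (toUnit (𝟙_ V)) (𝟙 _), Category.id_comp]
      rfl)
    (by
      refine (Category.assoc _ _ _).trans ((intι_tgt.{w} (D := (S : Type _)ᵒᵖ) (V := V)
        (a := op ⟨homInto G L, hG L⟩) (b := op ⟨W, hW⟩) lam.toElement).trans ?_)
      rw [toUnit_unique (toUnit (𝟙_ V)) (𝟙 _), Category.id_comp])

end Cones

end WeightedLimit

end

open WeightedLimit

/-!
Write `M c` for the object `V^I(W, C(c, G -))` of cones with vertex `c`. Restriction of the cone
`lam` defines maps `coneMap : C(c, L) ⟶ M c`. A `V`-natural transformation between `V`-valued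
`V`-functors is invertible as soon as its components are (`VNatTrans.isIso_iff`), so `(L, lam)` is
a weighted limit if and only if all of these maps are isomorphisms (`isWeightedLimit_iff`).

For a cone `x` with vertex `c`, a morphism of the comma category from `(c, x)` to `(L, lam)` is an
element `g` of `C(c, L)` which `coneMap` takes to `x`: squares in `Int (V^I)ᵒᵖ` whose bottom side is
an identity are commutative triangles (`undBase_cmp`, `exists_undBase_eq`), and extensivity
identifies the morphisms of `Int C` from `c` to `L` with `C(c, L)` (`exists_comp_intι_eq`). The
hom-object of `Und (W ↓ Int C(-, G))` is thus the fibre of `coneMap` over `x`.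

If every `coneMap` is an isomorphism, all these fibres are terminal. The terminal object of `V` need
not be connected, so an object of `Und (W ↓ Int C(-, G))` need not have a single object of `C` as
its vertex; but extensivity covers the terminal object by parts on which it has, and morphisms into
`(L, lam)` are constructed and compared on these parts (`isVTerminal_of_isIso`).

Conversely, terminality of the fibres over global elements only says that `coneMap` is bijective on
global elements (`bijective_of_isVTerminal`). If `t` is a tensor of `c` by `X`, maps `X ⟶ C(c, L)`
correspond to global elements of `C(t, L)`, and maps `X ⟶ M c` to global elements of `M t`
(`tensor_cone_ext`, `tensor_cone_exists`), compatibly with `coneMap`. Hence `coneMap` is bijective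
on generalized elements of every shape `X` in the conservative family (`bijective_of_tensors`), and
so it is an isomorphism.
-/

namespace WeightedLimit

/-! ### Isomorphisms of `V`-valued `V`-functors -/

section Components

variable {V : Type u} [Category.{v} V] [CartesianMonoidalCategory V] [MonoidalClosed V]
  {D : Type w₁} [EnrichedCategory V D] {F G H : EnrichedFunctor V D V}

/-- The map `F d ⟶ G d` of `V` whose name is the component of `α` at `d`. -/
noncomputable def VNatTrans.hom (α : VNatTrans F G) (d : D) : F.obj d ⟶ G.obj d :=
  WeightedLimit.app (toUnit (F.obj d) ≫ α.app d) (𝟙 (F.obj d))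

namespace VNatTrans

theorem app_toUnit_comp (α : VNatTrans F G) {d : D} {X : V} (k : X ⟶ 𝟙_ V) (g : X ⟶ F.obj d) :
    WeightedLimit.app (k ≫ α.app d) g = g ≫ α.hom d := by
  rw [hom, comp_app, ← Category.assoc, Category.comp_id, toUnit_unique (g ≫ toUnit _) k]

theorem hom_ext {α β : VNatTrans F G} (h : ∀ d, α.hom d = β.hom d) : α = β := by
  ext d
  apply app_ext
  intro Y k p
  rw [app_toUnit_comp, app_toUnit_comp, h]

theorem id_hom (d : D) : (VNatTrans.id F).hom d = 𝟙 (F.obj d) :=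
  app_eone (𝟙 (F.obj d))

theorem comp_hom (α : VNatTrans F G) (β : VNatTrans G H) (d : D) :
    (α.comp β).hom d = α.hom d ≫ β.hom d := by
  have e : (α.comp β).hom d =
      WeightedLimit.app (toUnit _ ≫ ecmp (α.app d) (β.app d)) (𝟙 (F.obj d)) := rfl
  rw [e, comp_ecmp, app_ecmp, app_toUnit_comp, app_toUnit_comp, Category.id_comp]

theorem hom_naturality (α : VNatTrans F G) {a b : D} {X : V} (f : X ⟶ (a ⟶[V] b))
    (p : X ⟶ F.obj a) :
    WeightedLimit.app (f ≫ F.map a b) p ≫ α.hom b =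
      WeightedLimit.app (f ≫ G.map a b) (p ≫ α.hom a) := by
  have h := congrArg (fun t => WeightedLimit.app (f ≫ t) p) (α.naturality a b)
  simp only [comp_ecmp, app_ecmp] at h
  rwa [← Category.assoc, ← Category.assoc, app_toUnit_comp, app_toUnit_comp] at h

theorem isIso_iff (α : VNatTrans F G) : α.IsIso ↔ ∀ d, CategoryTheory.IsIso (α.hom d) := by
  constructor
  · rintro ⟨β, h₁, h₂⟩ d
    refine ⟨β.hom d, ?_, ?_⟩
    · rw [← comp_hom, h₁, id_hom]
    · rw [← comp_hom, h₂, id_hom]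
  · intro h
    let β : VNatTrans G F :=
      { app := fun d => curry' (inv (α.hom d))
        naturality := fun a b => by
          apply app_ext
          intro Y k p
          rw [comp_ecmp, comp_ecmp, app_ecmp, app_ecmp, ← Category.assoc, ← Category.assoc,
            app_curry', app_curry', IsIso.comp_inv_eq, hom_naturality, Category.assoc,
            IsIso.inv_hom_id, Category.comp_id] }
    have hβ : ∀ d, β.hom d = inv (α.hom d) := fun d =>
      (app_curry' (inv (α.hom d)) (𝟙 _) _).trans (Category.id_comp _)
    refine ⟨β, hom_ext fun d => ?_, hom_ext fun d => ?_⟩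
    · rw [comp_hom, hβ, IsIso.hom_inv_id, id_hom]
    · rw [comp_hom, hβ, IsIso.inv_hom_id, id_hom]

end VNatTrans

end Components

section

variable {V : Type u} [Category.{v} V] [CartesianMonoidalCategory V] [MonoidalClosed V]
  [HasPullbacks V]

theorem VNatTrans.exists_toElement_eq {C : Type w₁} [EnrichedCategory V C] {D : Type w₂}
    [EnrichedCategory V D] [HasProductsOfShape C V] {F G : EnrichedFunctor V C D}
    (x : 𝟙_ V ⟶ (F ⟶[V] G)) : ∃ α : VNatTrans F G, α.toElement = x := by
  refine ⟨⟨fun a => x ≫ natProj F G a, fun a b => ?_⟩, ?_⟩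
  · have h := natProj_naturality F G (toUnit (a ⟶[V] b) ≫ x) (𝟙 (a ⟶[V] b))
    simpa only [Category.id_comp, Category.assoc] using h
  · exact natObj_ext fun a => natLift_proj _ _ _ _ a

end

/-! ### Weighted limits in terms of cones -/

section Cones

variable {V : Type u} [Category.{v} V] [CartesianMonoidalCategory V] [MonoidalClosed V]
  {C : Type w₁} [EnrichedCategory V C] {I : Type w₂} [EnrichedCategory V I]
  {G : EnrichedFunctor V I C} {W : EnrichedFunctor V I V}

theorem app_homInto_map {X : V} {a : C} {i j : I} (f : X ⟶ (i ⟶[V] j))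
    (p : X ⟶ (a ⟶[V] G.obj i)) :
    app (P := (homInto G a).obj i) (Q := (homInto G a).obj j) (f ≫ (homInto G a).map i j) p =
      ecmp p (f ≫ G.map i j) := by
  have h := app_postcomp (f ≫ G.map i j) p
  rw [Category.assoc] at h
  exact h

variable [HasPullbacks V] [HasProductsOfShape I V]

variable (G) in
/-- The restriction of a generalized cone with vertex `b` along a generalized element of
`C(a, b)`. -/
noncomputable def restrictCone {X : V} {a b : C} (g : X ⟶ (a ⟶[V] b))
    (m : X ⟶ (W ⟶[V] homInto G b)) : X ⟶ (W ⟶[V] homInto G a) :=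
  ecmp m (g ≫ homIntoMap G a b)

theorem comp_restrictCone {X Y : V} {a b : C} (k : Y ⟶ X) (g : X ⟶ (a ⟶[V] b))
    (m : X ⟶ (W ⟶[V] homInto G b)) :
    k ≫ restrictCone G g m = restrictCone G (k ≫ g) (k ≫ m) := by
  rw [restrictCone, comp_ecmp, restrictCone, Category.assoc]

/-- The value at `p` of the component at `i` of a generalized cone `m`. -/
noncomputable def coneApp {X : V} {a : C} (m : X ⟶ (W ⟶[V] homInto G a)) (i : I)
    (p : X ⟶ W.obj i) : X ⟶ (a ⟶[V] G.obj i) :=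
  app (P := W.obj i) (Q := (homInto G a).obj i) (m ≫ natProj W (homInto G a) i) p

theorem comp_coneApp {X Y : V} {a : C} (k : Y ⟶ X) (m : X ⟶ (W ⟶[V] homInto G a)) (i : I)
    (p : X ⟶ W.obj i) : k ≫ coneApp m i p = coneApp (k ≫ m) i (k ≫ p) := by
  refine (comp_app k (m ≫ natProj W (homInto G a) i) p).trans ?_
  exact congrArg (app · (k ≫ p)) (Category.assoc _ _ _).symm

theorem coneApp_naturality {X : V} {a : C} (m : X ⟶ (W ⟶[V] homInto G a)) {i j : I}
    (f : X ⟶ (i ⟶[V] j)) (p : X ⟶ W.obj i) :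
    coneApp m j (app (f ≫ W.map i j) p) = ecmp (coneApp m i p) (f ≫ G.map i j) := by
  have h := congrArg (fun q => app q p) (natProj_naturality W (homInto G a) m f)
  simp only [app_ecmp] at h
  exact h.trans (app_homInto_map f (coneApp m i p))

/-- Cones are restricted by composing each of their components with the given morphism. -/
theorem coneApp_restrictCone {X : V} {a b : C} (g : X ⟶ (a ⟶[V] b))
    (m : X ⟶ (W ⟶[V] homInto G b)) (i : I) (p : X ⟶ W.obj i) :
    coneApp (restrictCone G g m) i p = ecmp g (coneApp m i p) := by
  refine (congrArg (app · p) (ecmp_natProj m (g ≫ homIntoMap G a b) i)).trans ?_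
  rw [app_ecmp, Category.assoc, homIntoMap_proj]
  exact app_precomp g (coneApp m i p)

theorem cone_ext {X : V} {a : C} {m m' : X ⟶ (W ⟶[V] homInto G a)}
    (h : ∀ (i : I) (Y : V) (k : Y ⟶ X) (p : Y ⟶ W.obj i),
      coneApp (k ≫ m) i p = coneApp (k ≫ m') i p) : m = m' :=
  natObj_ext fun i => app_ext fun Y k p =>
    (congrArg (app · p) (Category.assoc k m (natProj W (homInto G a) i)).symm).trans
      ((h i Y k p).trans (congrArg (app · p) (Category.assoc k m' (natProj W (homInto G a) i))))

/-- The cone whose components are the transposes of a natural family of maps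
`W i ⟶ C(a, G i)`. -/
noncomputable def coneOfMaps {a : C} (k : ∀ i, W.obj i ⟶ (a ⟶[V] G.obj i))
    (h : ∀ (i j : I) (X : V) (f : X ⟶ (i ⟶[V] j)) (p : X ⟶ W.obj i),
      app (f ≫ W.map i j) p ≫ k j = ecmp (p ≫ k i) (f ≫ G.map i j)) :
    VNatTrans W (homInto G a) where
  app i := curry' (k i)
  naturality i j := app_ext fun X f p => by
    rw [comp_ecmp, comp_ecmp, app_ecmp, app_ecmp, ← Category.assoc, ← Category.assoc]
    refine (app_curry' _ _ _).trans ((h i j X f p).trans ?_)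
    refine Eq.trans ?_ (app_homInto_map f _).symm
    exact congrArg (ecmp · (f ≫ G.map i j)) (app_curry' _ _ _).symm

theorem coneApp_coneOfMaps {a : C} (k : ∀ i, W.obj i ⟶ (a ⟶[V] G.obj i)) (h) {X : V}
    (l : X ⟶ 𝟙_ V) (i : I) (p : X ⟶ W.obj i) :
    coneApp (l ≫ (coneOfMaps (G := G) k h).toElement) i p = p ≫ k i := by
  refine (congrArg (app · p) (Category.assoc l _ (natProj W (homInto G a) i))).trans ?_
  refine Eq.trans ?_ (app_curry' (k i) p l)
  exact congrArg (fun q => app (l ≫ q) p) (natLift_proj _ _ _ _ i)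

theorem restrictCone_ecmp {X : V} {a b c : C} (f : X ⟶ (a ⟶[V] b)) (g : X ⟶ (b ⟶[V] c))
    (m : X ⟶ (W ⟶[V] homInto G c)) :
    restrictCone G (ecmp f g) m = restrictCone G f (restrictCone G g m) := by
  apply cone_ext
  intro i Y k p
  rw [comp_restrictCone, comp_restrictCone, comp_restrictCone, coneApp_restrictCone,
    coneApp_restrictCone, coneApp_restrictCone, comp_ecmp, ecmp_assoc]

variable (G W) in
/-- The map `C(c, L) ⟶ V^I(W, C(c, G -))` which restricts the cone `lam`. -/
noncomputable def coneMap (L : C) (lam : VNatTrans W (homInto G L)) (c : C) :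
    (c ⟶[V] L) ⟶ (W ⟶[V] homInto G c) :=
  restrictCone G (𝟙 _) (toUnit _ ≫ lam.toElement)

theorem comp_coneMap {L : C} (lam : VNatTrans W (homInto G L)) {X : V} {c : C}
    (g : X ⟶ (c ⟶[V] L)) :
    g ≫ coneMap G W L lam c = restrictCone G g (toUnit X ≫ lam.toElement) := by
  rw [coneMap, comp_restrictCone, Category.comp_id, ← Category.assoc, comp_toUnit]

theorem ecmp_coneMap {L : C} (lam : VNatTrans W (homInto G L)) {X : V} {c d : C}
    (f : X ⟶ (c ⟶[V] d)) (g : X ⟶ (d ⟶[V] L)) :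
    ecmp f g ≫ coneMap G W L lam c = restrictCone G f (g ≫ coneMap G W L lam d) := by
  rw [comp_coneMap, comp_coneMap, restrictCone_ecmp]

theorem isWeightedLimit_iff [BraidedCategory V] {L : C} (lam : VNatTrans W (homInto G L)) :
    IsWeightedLimit G W L lam ↔ ∀ c, IsIso (coneMap G W L lam c) := by
  have e : ∀ c : C, (elementNatTrans (coneFunctor G W) (op L) lam.toElement).hom (op c) =
      coneMap G W L lam c := fun c => by
    refine (app_curry' (app ((coneFunctor G W).map (op L) (op c)) (toUnit _ ≫ lam.toElement))
      (𝟙 _) _).trans ((Category.id_comp _).trans ?_)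
    refine (app_postcomp (C := EnrichedFunctor V I V) (homIntoMap G c L) _).trans ?_
    rw [coneMap, restrictCone, Category.id_comp]
    rfl
  refine (VNatTrans.isIso_iff _).trans ?_
  constructor
  · intro h c
    rw [← e]
    exact h (op c)
  · intro h c
    have := h c.unop
    rwa [← e] at this

end Cones

/-! ### Tensors -/

section Tensors

variable {V : Type u} [Category.{v} V] [CartesianMonoidalCategory V] [MonoidalClosed V]
  {C : Type w₁} [EnrichedCategory V C] {X : V} {c t : C} {γ : X ⟶ (c ⟶[V] t)}

theorem tensor_app {a : C} {Y : V} (k : Y ⟶ (t ⟶[V] a)) (x : Y ⟶ X) :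
    app (k ≫ curry (γ ▷ (t ⟶[V] a) ≫ eComp V c t a)) x = ecmp (x ≫ γ) k := by
  rw [app_curry, ← Category.assoc, lift_whiskerRight, ecmp]

/-- Generalized elements of `C(t, a)`, where `t` is a tensor of `c` by `X`, are determined by
their composites with the universal family of elements of `C(c, t)`. -/
theorem tensor_ext {a : C} [IsIso (curry (γ ▷ (t ⟶[V] a) ≫ eComp V c t a))] {Y : V}
    {k l : Y ⟶ (t ⟶[V] a)}
    (h : ∀ (Z : V) (y : Z ⟶ Y) (x : Z ⟶ X),
      ecmp (x ≫ γ) (y ≫ k) = ecmp (x ≫ γ) (y ≫ l)) : k = l := by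
  rw [← cancel_mono (curry (γ ▷ (t ⟶[V] a) ≫ eComp V c t a))]
  apply app_ext
  intro Z y x
  rw [← Category.assoc, ← Category.assoc, tensor_app, tensor_app, h]

theorem tensor_exists {a : C} [IsIso (curry (γ ▷ (t ⟶[V] a) ≫ eComp V c t a))] {Y : V}
    (m : X ⊗ Y ⟶ (c ⟶[V] a)) :
    ∃ k : Y ⟶ (t ⟶[V] a), ∀ (Z : V) (y : Z ⟶ Y) (x : Z ⟶ X),
      ecmp (x ≫ γ) (y ≫ k) = lift x y ≫ m := by
  refine ⟨curry m ≫ inv (curry (γ ▷ (t ⟶[V] a) ≫ eComp V c t a)), fun Z y x => ?_⟩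
  rw [← tensor_app, Category.assoc, Category.assoc, IsIso.inv_hom_id, Category.comp_id,
    app_curry]

variable [HasPullbacks V] {I : Type w₂} [EnrichedCategory V I] [HasProductsOfShape I V]
  {G : EnrichedFunctor V I C} {W : EnrichedFunctor V I V}

theorem tensor_cone_ext (hγ : ∀ a, IsIso (curry (γ ▷ (t ⟶[V] a) ≫ eComp V c t a)))
    {m m' : 𝟙_ V ⟶ (W ⟶[V] homInto G t)}
    (h : restrictCone G γ (toUnit X ≫ m) = restrictCone G γ (toUnit X ≫ m')) : m = m' := by
  apply cone_ext
  intro i Y k p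
  have := hγ (G.obj i)
  refine tensor_ext (γ := γ) fun Z y x => ?_
  have h' := congrArg (fun q => coneApp (x ≫ q) i (y ≫ p)) h
  simp only [comp_restrictCone, coneApp_restrictCone] at h'
  have e : ∀ m : 𝟙_ V ⟶ (W ⟶[V] homInto G t), y ≫ coneApp (k ≫ m) i p =
      coneApp (x ≫ toUnit X ≫ m) i (y ≫ p) := fun m => by
    rw [comp_coneApp, ← Category.assoc, ← Category.assoc, toUnit_unique (y ≫ k) (x ≫ toUnit X)]
  rw [e, e, h']

/-- An `X`-indexed cone with vertex `c` is the restriction of a single cone with vertex the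
tensor of `c` by `X`. -/
theorem tensor_cone_exists (hγ : ∀ a, IsIso (curry (γ ▷ (t ⟶[V] a) ≫ eComp V c t a)))
    (m : X ⟶ (W ⟶[V] homInto G c)) :
    ∃ μ : VNatTrans W (homInto G t), restrictCone G γ (toUnit X ≫ μ.toElement) = m := by
  have key : ∀ i : I, ∃ k : W.obj i ⟶ (t ⟶[V] G.obj i), ∀ (Z : V) (y : Z ⟶ W.obj i)
      (x : Z ⟶ X), ecmp (x ≫ γ) (y ≫ k) = coneApp (x ≫ m) i y := fun i => by
    have := hγ (G.obj i)
    obtain ⟨k, hk⟩ := tensor_exists (γ := γ) (t := t)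
      (coneApp (fst X (W.obj i) ≫ m) i (snd X (W.obj i)))
    refine ⟨k, fun Z y x => (hk Z y x).trans ?_⟩
    rw [comp_coneApp, lift_fst_assoc, lift_snd]
  choose k hk using key
  refine ⟨coneOfMaps k fun i j Y f p => ?_, cone_ext fun i Y l p => ?_⟩
  · have := hγ (G.obj j)
    refine tensor_ext (γ := γ) fun Z y x => ?_
    rw [← Category.assoc, hk, comp_ecmp, ← ecmp_assoc, ← Category.assoc y p, hk, comp_app,
      ← Category.assoc y f, coneApp_naturality, Category.assoc]
  · rw [comp_restrictCone, coneApp_restrictCone, ← Category.assoc, coneApp_coneOfMaps, hk]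

end Tensors

/-! ### Hom-objects of comma categories -/

section CommaElements

variable {V : Type u} [Category.{v} V] [CartesianMonoidalCategory V] [HasPullbacks V]
  {A B : InternalCat V} (H : InternalFunctor A B) (b : 𝟙_ V ⟶ B.obj)

/-- The projection from the object of objects of `H ↓ b` to the object of objects of `A`. -/
noncomputable def commaObjFst : (comma H b).obj ⟶ A.obj :=
  pullback.fst (H.pair (InternalFunctor.const A b)).obj (B.arrowSrc.pair B.arrowTgt).obj

/-- The projection from the object of objects of `H ↓ b` to the object of morphisms of `B`. -/
noncomputable def commaObjSnd : (comma H b).obj ⟶ B.mor :=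
  pullback.snd (H.pair (InternalFunctor.const A b)).obj (B.arrowSrc.pair B.arrowTgt).obj

/-- The projection from the object of morphisms of `H ↓ b` to the object of morphisms of `A`. -/
noncomputable def commaMorFst : (comma H b).mor ⟶ A.mor :=
  pullback.fst (H.pair (InternalFunctor.const A b)).mor (B.arrowSrc.pair B.arrowTgt).mor

/-- The projection from the object of morphisms of `H ↓ b` to the object of squares in `B`. -/
noncomputable def commaMorSnd : (comma H b).mor ⟶ B.sq :=
  pullback.snd (H.pair (InternalFunctor.const A b)).mor (B.arrowSrc.pair B.arrowTgt).mor

theorem comma_src_fst : (comma H b).src ≫ commaObjFst H b = commaMorFst H b ≫ A.src :=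
  InternalCat.pbSrc_fst _ _

theorem comma_src_snd : (comma H b).src ≫ commaObjSnd H b = commaMorSnd H b ≫ B.sqLeft :=
  InternalCat.pbSrc_snd _ _

theorem comma_tgt_fst : (comma H b).tgt ≫ commaObjFst H b = commaMorFst H b ≫ A.tgt :=
  InternalCat.pbTgt_fst _ _

theorem comma_tgt_snd : (comma H b).tgt ≫ commaObjSnd H b = commaMorSnd H b ≫ B.sqRight :=
  InternalCat.pbTgt_snd _ _

variable {H b} {X : V}

theorem commaObj_ext {m n : X ⟶ (comma H b).obj} (h₁ : m ≫ commaObjFst H b = n ≫ commaObjFst H b)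
    (h₂ : m ≫ commaObjSnd H b = n ≫ commaObjSnd H b) : m = n :=
  pullback.hom_ext h₁ h₂

theorem commaObj_src : commaObjSnd H b ≫ B.src = commaObjFst H b ≫ H.obj := by
  have h : commaObjFst H b ≫ lift H.obj (toUnit _ ≫ b) = commaObjSnd H b ≫ lift B.src B.tgt :=
    pullback.condition
  have h' := congrArg (· ≫ fst _ _) h
  simpa only [Category.assoc, lift_fst] using h'.symm

theorem commaObj_tgt : commaObjSnd H b ≫ B.tgt = toUnit _ ≫ b := by
  have h : commaObjFst H b ≫ lift H.obj (toUnit _ ≫ b) = commaObjSnd H b ≫ lift B.src B.tgt :=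
    pullback.condition
  have h' := congrArg (· ≫ snd _ _) h
  simp only [Category.assoc, lift_snd] at h'
  rw [← h', ← Category.assoc, comp_toUnit]

theorem commaMor_top : commaMorSnd H b ≫ B.sqTop = commaMorFst H b ≫ H.mor := by
  have h : commaMorFst H b ≫ lift H.mor (toUnit _ ≫ b ≫ B.idn) =
      commaMorSnd H b ≫ lift B.sqTop B.sqBot :=
    pullback.condition
  have h' := congrArg (· ≫ fst _ _) h
  simpa only [Category.assoc, lift_fst] using h'.symm

theorem commaMor_bot : commaMorSnd H b ≫ B.sqBot = toUnit _ ≫ b ≫ B.idn := by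
  have h : commaMorFst H b ≫ lift H.mor (toUnit _ ≫ b ≫ B.idn) =
      commaMorSnd H b ≫ lift B.sqTop B.sqBot :=
    pullback.condition
  have h' := congrArg (· ≫ snd _ _) h
  simp only [Category.assoc, lift_snd] at h'
  rw [← h', ← Category.assoc, comp_toUnit]

variable {p q : 𝟙_ V ⟶ (comma H b).obj}

/-- The projection to `A.mor` of a generalized element of a hom-object of `Und (H ↓ b)`. -/
noncomputable def undBase (h : X ⟶ undHom (comma H b) p q) : X ⟶ A.mor :=
  (h ≫ undπ (comma H b) p q) ≫ commaMorFst H b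

theorem undBase_src (h : X ⟶ undHom (comma H b) p q) :
    undBase h ≫ A.src = toUnit X ≫ p ≫ commaObjFst H b := by
  rw [undBase, Category.assoc, ← comma_src_fst, ← Category.assoc, undπ_src, Category.assoc]

theorem undBase_tgt (h : X ⟶ undHom (comma H b) p q) :
    undBase h ≫ A.tgt = toUnit X ≫ q ≫ commaObjFst H b := by
  rw [undBase, Category.assoc, ← comma_tgt_fst, ← Category.assoc, undπ_tgt, Category.assoc]

theorem mor_comp_tgt_eq {f : X ⟶ A.mor} (hf : f ≫ A.tgt = toUnit X ≫ q ≫ commaObjFst H b) :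
    (f ≫ H.mor) ≫ B.tgt = (toUnit X ≫ q ≫ commaObjSnd H b) ≫ B.src := by
  simp only [Category.assoc]
  rw [H.mor_tgt, commaObj_src, ← Category.assoc, hf]
  simp only [Category.assoc]

theorem und_left (h : X ⟶ undHom (comma H b) p q) :
    ((h ≫ undπ (comma H b) p q) ≫ commaMorSnd H b) ≫ B.sqLeft =
      toUnit X ≫ p ≫ commaObjSnd H b := by
  rw [Category.assoc, ← comma_src_snd, ← Category.assoc, undπ_src, Category.assoc]

theorem und_right (h : X ⟶ undHom (comma H b) p q) :
    ((h ≫ undπ (comma H b) p q) ≫ commaMorSnd H b) ≫ B.sqRight =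
      toUnit X ≫ q ≫ commaObjSnd H b := by
  rw [Category.assoc, ← comma_tgt_snd, ← Category.assoc, undπ_tgt, Category.assoc]

theorem und_top (h : X ⟶ undHom (comma H b) p q) :
    ((h ≫ undπ (comma H b) p q) ≫ commaMorSnd H b) ≫ B.sqTop = undBase h ≫ H.mor := by
  simp only [undBase, Category.assoc, commaMor_top]

theorem und_bot (h : X ⟶ undHom (comma H b) p q) :
    ((h ≫ undπ (comma H b) p q) ≫ commaMorSnd H b) ≫ B.sqBot = toUnit X ≫ b ≫ B.idn := by
  rw [Category.assoc, commaMor_bot, ← Category.assoc, comp_toUnit]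

theorem toUnit_idn_eq (p : 𝟙_ V ⟶ (comma H b).obj) :
    toUnit X ≫ b ≫ B.idn = (toUnit X ≫ p ≫ commaObjSnd H b) ≫ B.tgt ≫ B.idn := by
  simp only [Category.assoc]
  rw [← Category.assoc (commaObjSnd H b), commaObj_tgt]
  simp only [← Category.assoc]
  rw [toUnit_unique (((toUnit X ≫ p) ≫ toUnit _)) (toUnit X)]

/-- A morphism of `H ↓ b` from `p` to `q` is a morphism `f` of `A` such that the composite of
`H f` and the arrow of `q` is the arrow of `p`. -/
theorem undBase_cmp (h : X ⟶ undHom (comma H b) p q) :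
    B.cmp (undBase h ≫ H.mor) (toUnit X ≫ q ≫ commaObjSnd H b) (mor_comp_tgt_eq (undBase_tgt h)) =
      toUnit X ≫ p ≫ commaObjSnd H b := by
  have e := InternalCat.sq_comm ((h ≫ undπ (comma H b) p q) ≫ commaMorSnd H b)
  rw [InternalCat.cmp_congr B (und_top h) (und_right h)] at e
  rw [← e]
  refine (InternalCat.cmp_idn_of_eq _ ?_ _).trans (und_left h)
  rw [und_bot, und_left]
  exact toUnit_idn_eq p

theorem undBase_inj {h h' : X ⟶ undHom (comma H b) p q} (e : undBase h = undBase h') : h = h' := by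
  apply und_ext
  apply pullback.hom_ext
  · exact e
  · apply InternalCat.sq_ext
    · exact (und_left h).trans (und_left h').symm
    · exact (und_bot h).trans (und_bot h').symm
    · exact (und_top h).trans ((congrArg (· ≫ H.mor) e).trans (und_top h').symm)
    · exact (und_right h).trans (und_right h').symm

/-- Converse of `undBase_cmp`: the square has left side the arrow of `p`, top side `H f`, right
side the arrow of `q`, and an identity as its bottom side. -/
theorem exists_undBase_eq (f : X ⟶ A.mor) (hs : f ≫ A.src = toUnit X ≫ p ≫ commaObjFst H b)
    (ht : f ≫ A.tgt = toUnit X ≫ q ≫ commaObjFst H b)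
    (hf : B.cmp (f ≫ H.mor) (toUnit X ≫ q ≫ commaObjSnd H b) (mor_comp_tgt_eq ht) =
      toUnit X ≫ p ≫ commaObjSnd H b) :
    ∃ h : X ⟶ undHom (comma H b) p q, undBase h = f := by
  have e : (toUnit X ≫ p ≫ commaObjSnd H b) ≫ B.tgt = (toUnit X ≫ b ≫ B.idn) ≫ B.src := by
    rw [toUnit_idn_eq p]
    simp only [Category.assoc, B.idn_src, Category.comp_id]
  let s : X ⟶ B.sq := InternalCat.sqMk (toUnit X ≫ p ≫ commaObjSnd H b) (toUnit X ≫ b ≫ B.idn)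
    (f ≫ H.mor) (toUnit X ≫ q ≫ commaObjSnd H b) e (mor_comp_tgt_eq ht)
    ((InternalCat.cmp_idn_of_eq _ (toUnit_idn_eq p) _).trans hf.symm)
  let m : X ⟶ (comma H b).mor :=
    pullback.lift (f := (H.pair (InternalFunctor.const A b)).mor)
      (g := (B.arrowSrc.pair B.arrowTgt).mor) f s (by
        change f ≫ lift H.mor (toUnit _ ≫ b ≫ B.idn) = s ≫ lift B.sqTop B.sqBot
        rw [comp_lift, comp_lift, ← Category.assoc f, comp_toUnit, InternalCat.sqMk_top,
          InternalCat.sqMk_bot])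
  have hm₁ : m ≫ commaMorFst H b = f := pullback.lift_fst _ _ _
  have hm₂ : m ≫ commaMorSnd H b = s := pullback.lift_snd _ _ _
  have hs' : m ≫ (comma H b).src = toUnit X ≫ p := commaObj_ext
    (by rw [Category.assoc, comma_src_fst, ← Category.assoc, hm₁, hs, Category.assoc])
    (by rw [Category.assoc, comma_src_snd, ← Category.assoc, hm₂, InternalCat.sqMk_left,
      Category.assoc])
  have ht' : m ≫ (comma H b).tgt = toUnit X ≫ q := commaObj_ext
    (by rw [Category.assoc, comma_tgt_fst, ← Category.assoc, hm₁, ht, Category.assoc])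
    (by rw [Category.assoc, comma_tgt_snd, ← Category.assoc, hm₂, InternalCat.sqMk_right,
      Category.assoc])
  exact ⟨undLift m hs' ht', by rw [undBase, undLift_π, hm₁]⟩

theorem commaElement_fst (a : 𝟙_ V ⟶ A.obj) (x : 𝟙_ V ⟶ B.mor) (hs ht) :
    commaElement H b a x hs ht ≫ commaObjFst H b = a :=
  pullback.lift_fst _ _ _

theorem commaElement_snd (a : 𝟙_ V ⟶ A.obj) (x : 𝟙_ V ⟶ B.mor) (hs ht) :
    commaElement H b a x hs ht ≫ commaObjSnd H b = x :=
  pullback.lift_snd _ _ _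

end CommaElements

/-! ### Morphisms of weighted cones -/

section IntLift

variable {V : Type u} [Category.{v} V] [CartesianMonoidalCategory V] [MonoidalClosed V]
  [Extensive.{w} V] {D : Type w₁} [EnrichedCategory V D] [Small.{w} D]

/-- The hom-object `D(a, b)` is the object of morphisms of `Int D` from `a` to `b`. -/
theorem exists_comp_intι_eq {X : V} {a b : D} (f : X ⟶ intMor.{w} (V := V) D)
    (hs : f ≫ intSrc.{w} D = toUnit X ≫ intEl.{w} D a)
    (ht : f ≫ intTgt.{w} D = toUnit X ≫ intEl.{w} D b) :
    ∃ g : X ⟶ (a ⟶[V] b), g ≫ intι.{w} D a b = f := by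
  -- Locally `f` lies in some `D(a', b')`, and then `(a', b') = (a, b)` unless `Y` is initial.
  apply intMor_glue_exists f
  intro Y a' b' k x e
  have h₁ : toUnit Y ≫ intEl.{w} D a' = toUnit Y ≫ intEl.{w} D a := by
    rw [← intι_src x, ← Category.assoc, ← e, Category.assoc, hs, ← Category.assoc, comp_toUnit]
  have h₂ : toUnit Y ≫ intEl.{w} D b' = toUnit Y ≫ intEl.{w} D b := by
    rw [← intι_tgt x, ← Category.assoc, ← e, Category.assoc, ht, ← Category.assoc, comp_toUnit]
  rcases intEl_cases h₁ with rfl | h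
  · rcases intEl_cases h₂ with rfl | h
    · exact ⟨x, e.symm⟩
    · obtain ⟨y⟩ := h (a' ⟶[V] b)
      exact ⟨y.default, eq_of_nonempty_unique h _ _⟩
  · obtain ⟨y⟩ := h (a ⟶[V] b)
    exact ⟨y.default, eq_of_nonempty_unique h _ _⟩

end IntLift

section ConeCategory

variable {V : Type u} [Category.{v} V] [CartesianMonoidalCategory V]
    [BraidedCategory V] [MonoidalClosed V] [HasPullbacks V] [Extensive.{w} V]
    {C : Type w₁} [EnrichedCategory V C]
    {I : Type w₂} [EnrichedCategory V I] [HasProductsOfShape I V]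
    (G : EnrichedFunctor V I C) (W : EnrichedFunctor V I V)
    (S : Set (EnrichedFunctor V I V)) [Small.{w} S] (hW : W ∈ S)
    (hG : ∀ a : C, homInto G a ∈ S)

/-- The inclusion of the object of cones with vertex `c` in the object of morphisms of
`Int (V^I)ᵒᵖ`. -/
noncomputable def coneι (c : C) : (W ⟶[V] homInto G c) ⟶ intMor.{w} (V := V) (S : Type _)ᵒᵖ :=
  intι.{w} (S : Type _)ᵒᵖ (op ⟨homInto G c, hG c⟩) (op ⟨W, hW⟩)

variable {G W S hW hG} in
theorem coneι_inj {X : V} {c : C} {x y : X ⟶ (W ⟶[V] homInto G c)}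
    (h : x ≫ coneι G W S hW hG c = y ≫ coneι G W S hW hG c) : x = y :=
  intι_inj.{w} (D := (S : Type _)ᵒᵖ) (a := op ⟨homInto G c, hG c⟩) (b := op ⟨W, hW⟩)
    (x := x) (x' := y) h

variable [Small.{w} C]

/-- The projection of `W ↓ Int C(-, G)` to the vertex of a cone. -/
noncomputable def coneVertex : (weightedCones.{w} G W S hW hG).obj ⟶ intObj.{w} (V := V) C :=
  commaObjFst (coneInternalFunctor.{w} G S hG) (intEl.{w} (S : Type _)ᵒᵖ (op ⟨W, hW⟩))

/-- The projection of `W ↓ Int C(-, G)` to the underlying morphism of `Int (V^I)ᵒᵖ`. -/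
noncomputable def coneArrow :
    (weightedCones.{w} G W S hW hG).obj ⟶ intMor.{w} (V := V) (S : Type _)ᵒᵖ :=
  commaObjSnd (coneInternalFunctor.{w} G S hG) (intEl.{w} (S : Type _)ᵒᵖ (op ⟨W, hW⟩))

variable {G W S hW hG}

theorem coneElement_vertex (L : C) (lam : VNatTrans W (homInto G L)) :
    coneElement.{w} G W S hW hG L lam ≫ coneVertex G W S hW hG = intEl.{w} C L :=
  commaElement_fst _ _ _ _

theorem coneElement_arrow (L : C) (lam : VNatTrans W (homInto G L)) :
    coneElement.{w} G W S hW hG L lam ≫ coneArrow G W S hW hG =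
      lam.toElement ≫ coneι G W S hW hG L :=
  commaElement_snd _ _ _ _

/-- A generalized element of the object of cones whose vertex is a single object `c` is given by a
generalized cone with vertex `c`. -/
theorem exists_cone_eq {X : V} (p : X ⟶ (weightedCones.{w} G W S hW hG).obj) {c : C}
    (hc : p ≫ coneVertex G W S hW hG = toUnit X ≫ intEl.{w} C c) :
    ∃ x : X ⟶ (W ⟶[V] homInto G c), x ≫ coneι G W S hW hG c = p ≫ coneArrow G W S hW hG := by
  refine exists_comp_intι_eq.{w} (D := (S : Type _)ᵒᵖ) (a := op ⟨homInto G c, hG c⟩)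
    (b := op ⟨W, hW⟩) (p ≫ coneArrow G W S hW hG) ?_ ?_
  · have h : coneArrow G W S hW hG ≫ intSrc.{w} (V := V) (S : Type _)ᵒᵖ =
        coneVertex G W S hW hG ≫ intMapObj.{w} _ := commaObj_src
    rw [Category.assoc, h, ← Category.assoc, hc, Category.assoc, intEl_mapObj]
    rfl
  · have h : coneArrow G W S hW hG ≫ intTgt.{w} (V := V) (S : Type _)ᵒᵖ =
        toUnit _ ≫ intEl.{w} (S : Type _)ᵒᵖ (op ⟨W, hW⟩) := commaObj_tgt
    rw [Category.assoc, h, ← Category.assoc, comp_toUnit]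

variable {p : 𝟙_ V ⟶ (weightedCones.{w} G W S hW hG).obj} {L : C}
  {lam : VNatTrans W (homInto G L)} {X : V} {c : C}

theorem cone_cmp (g : X ⟶ (c ⟶[V] L)) {f : X ⟶ intMor.{w} (V := V) C} (hf : f = g ≫ intι.{w} C c L)
    (h) :
    (Int.{w} (V := V) (S : Type _)ᵒᵖ).cmp (f ≫ (coneInternalFunctor.{w} G S hG).mor)
      (toUnit X ≫ coneElement.{w} G W S hW hG L lam ≫ coneArrow G W S hW hG) h =
      (g ≫ coneMap G W L lam c) ≫ coneι G W S hW hG c := by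
  refine (intCmp_of_eq.{w} (D := (S : Type _)ᵒᵖ) (a := op ⟨homInto G c, hG c⟩)
    (b := op ⟨homInto G L, hG L⟩) (c := op ⟨W, hW⟩) (x := g ≫ homIntoMap G c L)
    (y := toUnit X ≫ lam.toElement) ?_ ?_ h).trans ?_
  · subst hf
    refine (Category.assoc _ _ _).trans (Eq.trans ?_ (Category.assoc _ _ _).symm)
    exact congrArg (g ≫ ·) (intι_mapMor.{w} _ c L)
  · exact (congrArg (toUnit X ≫ ·) (coneElement_arrow L lam)).trans (Category.assoc _ _ _).symm
  · rw [ecmp_op, comp_coneMap]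
    rfl

/-- For a cone `x` with vertex `c`, a generalized element `g` of `C(c, L)` which takes the cone
`lam` to `x` is a morphism of cones from `x` to `lam`. -/
theorem exists_coneMorphism (hc : toUnit X ≫ p ≫ coneVertex G W S hW hG = toUnit X ≫ intEl.{w} C c)
    (g : X ⟶ (c ⟶[V] L))
    (hg : (g ≫ coneMap G W L lam c) ≫ coneι G W S hW hG c =
      toUnit X ≫ p ≫ coneArrow G W S hW hG) :
    ∃ h : X ⟶ undHom (weightedCones.{w} G W S hW hG) p (coneElement.{w} G W S hW hG L lam),
      undBase h = g ≫ intι.{w} C c L := by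
  refine exists_undBase_eq _ ?_ ?_ ?_
  · refine Eq.trans ?_ hc.symm
    exact (Category.assoc _ _ _).trans (intι_src.{w} g)
  · refine ((Category.assoc _ _ _).trans (intι_tgt.{w} g)).trans ?_
    exact congrArg (toUnit X ≫ ·) (coneElement_vertex (hW := hW) (hG := hG) L lam).symm
  · exact (cone_cmp g rfl _).trans hg

theorem coneMorphism_cases (hc : toUnit X ≫ p ≫ coneVertex G W S hW hG = toUnit X ≫ intEl.{w} C c)
    (h : X ⟶ undHom (weightedCones.{w} G W S hW hG) p (coneElement.{w} G W S hW hG L lam)) :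
    ∃ g : X ⟶ (c ⟶[V] L), undBase h = g ≫ intι.{w} C c L ∧
      (g ≫ coneMap G W L lam c) ≫ coneι G W S hW hG c =
        toUnit X ≫ p ≫ coneArrow G W S hW hG := by
  obtain ⟨g, hg⟩ := exists_comp_intι_eq.{w} (undBase h) ((undBase_src h).trans hc)
    ((undBase_tgt h).trans
      (congrArg (toUnit X ≫ ·) (coneElement_vertex (hW := hW) (hG := hG) L lam)))
  exact ⟨g, hg.symm, (cone_cmp g hg.symm _).symm.trans (undBase_cmp h)⟩

/-- If restriction of `lam` is invertible then `lam` is `V`-terminal. An element of the object of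
cones need not have a single vertex, but the terminal object is covered by parts on which it has,
and morphisms into `lam` can be constructed and compared locally on such a cover. -/
theorem isVTerminal_of_isIso (h : ∀ c, IsIso (coneMap G W L lam c)) :
    IsVTerminal (V := V) (coneElement.{w} G W S hW hG L lam) := by
  intro (p : 𝟙_ V ⟶ (weightedCones.{w} G W S hW hG).obj)
  change IsIso (toUnit (undHom (weightedCones.{w} G W S hW hG) p
    (coneElement.{w} G W S hW hG L lam)))
  have local_eq : ∀ {Y : V} {c : C} (k : Y ⟶ 𝟙_ V) (b : Y ⟶ 𝟙_ V),
      k ≫ p ≫ coneVertex G W S hW hG = b ≫ intEl.{w} C c →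
      toUnit Y ≫ p ≫ coneVertex G W S hW hG = toUnit Y ≫ intEl.{w} C c := fun k b e => by
    rwa [toUnit_unique k (toUnit _), toUnit_unique b (toUnit _)] at e
  have uniq : ∀ {X : V} (f f' : X ⟶ undHom (weightedCones.{w} G W S hW hG) p
      (coneElement.{w} G W S hW hG L lam)), f = f' := fun {X} f f' => by
    apply sig_glue_unique (D := C) (X := fun _ => 𝟙_ V)
      (toUnit X ≫ p ≫ coneVertex G W S hW hG)
    intro Y c k b e
    have hc := local_eq (k ≫ toUnit X) b (by rw [Category.assoc]; exact e)
    obtain ⟨g, hg, hg'⟩ := coneMorphism_cases hc (k ≫ f)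
    obtain ⟨g', hh, hh'⟩ := coneMorphism_cases hc (k ≫ f')
    have e₁ : g = g' := by
      have := h c
      rw [← cancel_mono (coneMap G W L lam c)]
      exact coneι_inj (hg'.trans hh'.symm)
    exact undBase_inj (by rw [hg, hh, e₁])
  have ex : ∃ l : 𝟙_ V ⟶ undHom (weightedCones.{w} G W S hW hG) p
      (coneElement.{w} G W S hW hG L lam), l ≫ toUnit _ = 𝟙 (𝟙_ V) := by
    apply sig_glue_exists (D := C) (X := fun _ => 𝟙_ V) (p ≫ coneVertex G W S hW hG)
    intro Y c k b e
    have hc := local_eq k b e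
    obtain ⟨x, hx⟩ := exists_cone_eq (toUnit Y ≫ p) ((Category.assoc _ _ _).trans hc)
    have := h c
    obtain ⟨l, _⟩ := exists_coneMorphism hc (x ≫ inv (coneMap G W L lam c)) (by
      rw [Category.assoc x, IsIso.inv_hom_id, Category.comp_id, hx, Category.assoc])
    exact ⟨l, toUnit_unique _ _⟩
  obtain ⟨l, hl⟩ := ex
  exact ⟨l, uniq _ _, hl⟩

/-- If `lam` is `V`-terminal then every cone is uniquely a restriction of `lam`. -/
theorem bijective_of_isVTerminal
    (h : IsVTerminal (V := V) (coneElement.{w} G W S hW hG L lam)) (c : C) :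
    Function.Bijective (fun g : 𝟙_ V ⟶ (c ⟶[V] L) => g ≫ coneMap G W L lam c) := by
  have key : ∀ μ : VNatTrans W (homInto G c), ∃! g : 𝟙_ V ⟶ (c ⟶[V] L),
      g ≫ coneMap G W L lam c = μ.toElement := fun μ => by
    have hμ : IsIso (toUnit (undHom (weightedCones.{w} G W S hW hG)
        (coneElement.{w} G W S hW hG c μ) (coneElement.{w} G W S hW hG L lam))) :=
      h (coneElement.{w} G W S hW hG c μ)
    have hc : toUnit (𝟙_ V) ≫ coneElement.{w} G W S hW hG c μ ≫ coneVertex G W S hW hG =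
        toUnit (𝟙_ V) ≫ intEl.{w} C c :=
      congrArg (toUnit (𝟙_ V) ≫ ·) (coneElement_vertex c μ)
    have ha : toUnit (𝟙_ V) ≫ coneElement.{w} G W S hW hG c μ ≫ coneArrow G W S hW hG =
        μ.toElement ≫ coneι G W S hW hG c :=
      (congrArg (toUnit (𝟙_ V) ≫ ·) (coneElement_arrow c μ)).trans
        (by rw [toUnit_unique (toUnit (𝟙_ V)) (𝟙 _), Category.id_comp])
    obtain ⟨g, -, hg⟩ := coneMorphism_cases hc (inv (toUnit (undHom (weightedCones.{w} G W S hW hG)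
        (coneElement.{w} G W S hW hG c μ) (coneElement.{w} G W S hW hG L lam))))
    refine ⟨g, coneι_inj (hg.trans ha), fun g' hg' => ?_⟩
    obtain ⟨l, hl⟩ := exists_coneMorphism hc g hg
    obtain ⟨l', hl'⟩ := exists_coneMorphism hc g'
      ((congrArg (· ≫ coneι G W S hW hG c) hg').trans ha.symm)
    have e : l' = l := by
      rw [← cancel_mono (toUnit (undHom (weightedCones.{w} G W S hW hG)
        (coneElement.{w} G W S hW hG c μ) (coneElement.{w} G W S hW hG L lam)))]
      exact toUnit_unique _ _
    exact intι_inj.{w} (by rw [← hl, ← hl', e])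
  constructor
  · intro g g' e
    obtain ⟨μ, hμ⟩ := VNatTrans.exists_toElement_eq (g ≫ coneMap G W L lam c)
    exact (key μ).unique hμ.symm (e.symm.trans hμ.symm)
  · intro x
    obtain ⟨μ, rfl⟩ := VNatTrans.exists_toElement_eq x
    exact (key μ).exists

end ConeCategory

/-! ### Reduction to global elements by means of tensors -/

/-- In the presence of tensors by `X`, bijectivity of `C(t, L) ⟶ V^I(W, C(t, G -))` on elements
for all `t` implies its bijectivity on `X`-indexed generalized elements. -/
theorem bijective_of_tensors {V : Type u} [Category.{v} V] [CartesianMonoidalCategory V]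
    [MonoidalClosed V] [HasPullbacks V] {C : Type w₁} [EnrichedCategory V C]
    {I : Type w₂} [EnrichedCategory V I] [HasProductsOfShape I V]
    {G : EnrichedFunctor V I C} {W : EnrichedFunctor V I V} {L : C}
    {lam : VNatTrans W (homInto G L)}
    (h : ∀ t, Function.Bijective (fun g : 𝟙_ V ⟶ (t ⟶[V] L) => g ≫ coneMap G W L lam t))
    {X : V} (hX : HasTensorsBy X C) (c : C) :
    Function.Bijective (fun g : X ⟶ (c ⟶[V] L) => g ≫ coneMap G W L lam c) := by
  obtain ⟨t, γ, hγ⟩ := hX c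
  have := hγ L
  have restrict : ∀ f : 𝟙_ V ⟶ (t ⟶[V] L),
      ecmp γ (toUnit X ≫ f) ≫ coneMap G W L lam c =
        restrictCone G γ (toUnit X ≫ f ≫ coneMap G W L lam t) := fun f => by
    rw [ecmp_coneMap, Category.assoc]
  have lifts : ∀ g : X ⟶ (c ⟶[V] L), ∃ f : 𝟙_ V ⟶ (t ⟶[V] L), ecmp γ (toUnit X ≫ f) = g :=
    fun g => by
      obtain ⟨f, hf⟩ := tensor_exists (γ := γ) (t := t) (Y := 𝟙_ V) (fst X (𝟙_ V) ≫ g)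
      have := hf X (toUnit X) (𝟙 X)
      rw [Category.id_comp, lift_fst_assoc, Category.id_comp] at this
      exact ⟨f, this⟩
  constructor
  · intro g g' e
    obtain ⟨f, rfl⟩ := lifts g
    obtain ⟨f', rfl⟩ := lifts g'
    simp only [restrict] at e
    rw [(h t).1 (tensor_cone_ext hγ e)]
  · intro m
    obtain ⟨μ, hμ⟩ := tensor_cone_exists hγ m
    obtain ⟨f, hf⟩ := (h t).2 μ.toElement
    refine ⟨ecmp γ (toUnit X ≫ f), ?_⟩
    change f ≫ _ = _ at hf
    change _ ≫ _ = _
    rw [restrict, hf, hμ]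

end WeightedLimit

theorem mainTheorem10 {V : Type u} [Category.{v} V] [CartesianMonoidalCategory V]
    [BraidedCategory V] [MonoidalClosed V] [HasPullbacks V] [Extensive.{w} V]
    {C : Type w₁} [EnrichedCategory V C] [Small.{w} C]
    {I : Type w₂} [EnrichedCategory V I] [HasProductsOfShape I V]
    (𝒢 : Set V) (h𝒢 : IsConservative 𝒢) (hC : ∀ X ∈ 𝒢, HasTensorsBy X C)
    (G : EnrichedFunctor V I C) (W : EnrichedFunctor V I V)
    (S : Set (EnrichedFunctor V I V)) [Small.{w} S] (hW : W ∈ S)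
    (hG : ∀ a : C, homInto G a ∈ S)
    (L : C) (lam : VNatTrans W (homInto G L)) :
    IsWeightedLimit G W L lam ↔
      IsVTerminal (V := V) (coneElement.{w} G W S hW hG L lam) := by
  rw [isWeightedLimit_iff]
  exact ⟨isVTerminal_of_isIso, fun h c => (h𝒢 _).2 fun X hX =>
    bijective_of_tensors (bijective_of_isVTerminal h) (hC X hX) c⟩
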